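/- Let $n,p,q\ge 0$ be integers, let $J=[0,\infty)$, and let $A:J\to\mathbb R^{n\times n}$, $D:J\to\mathbb R^{n\times q}$, $C:J\to\mathbb R^{p\times n}$ be such that: (A1) $A$ and $D$ are uniformly bounded and differentiable on $J$ with uniformly bounded derivatives; (A2) $C$ is uniformly bounded and twice differentiable on $J$, and $\dot C,\ddot C$ are uniformly bounded; (A3) there is $\gamma>0$ such that $\Gamma(t)=C(t)D(t)$ satisfies $\Gamma(t)^{\mathsf T}\Gamma(t)\succeq\gamma I_q$ for all $t\in J$. (Derivatives at $t=0$ are one-sided; $\|\cdot\|$ is the Euclidean norm and the induced matrix norm; solutions of differential equations on $J$ are locally absolutely continuous functions satisfying the equation almost everywhere.) Consider the system $\dot x=A(t)x+D(t)w$, $y=C(t)x$ on $J$, with unknown input $w$. It is called uniformly strong$^*$ detectable if there exist uniformly bounded measurable $N:J\to\mathbb R^{n\times n}$, $R:J\to\mathbb R^{n\times p}$, a uniformly bounded Lipschitz continuous $S:J\to\mathbb R^{n\times p}$, and constants $M,\mu>0$ such that, for every locally integrable $w:J\to\mathbb R^q$, every solution $x$ of the system with output $y=C(t)x$, and every solution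 $z$ of $\dot z=N(t)z+R(t)y$, the error $e=x-\hat x$ of the estimate $\hat x=z+S(t)y$ satisfies $$\|e(t)\|\le M e^{-\mu(t-t_0)}\|e(t_0)\|\qquad\text{for all } t\ge t_0\ge 0 .$$ A pair $(F,H)$ of matrix functions $F:J\to\mathbb R^{n\times n}$, $H:J\to\mathbb R^{m\times n}$ is called uniformly exponentially detectable if there exist a uniformly bounded measurable $L:J\to\mathbb R^{n\times m}$ and constants $M,\mu>0$ such that every solution $e$ of $\dot e=[F(t)-L(t)H(t)]e$ satisfies the same inequality for all $t\ge t_0\ge0$. Then the following statements are equivalent: (i) the system $\dot x=A(t)x+D(t)w$, $y=C(t)x$ is uniformly strong$^*$ detectable; (ii) the pair $(\tilde A,\tilde C)$ is uniformly exponentially detectable, where, with $\Gamma^\dagger(t)$ the Moore–Penrose pseudoinverse of $\Gamma(t)$, $$\tilde A(t)=A(t)-D(t)\Gamma^\dagger(t)\bigl[C(t)A(t)+\dot C(t)\bigr],\qquad \tilde C(t)=\begin{bmatrix}C(t)\\ C(t)\tilde A(t)+\dot C(t)\end{bmatrix}.$$ -/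

import Mathlib

open Set MeasureTheory Matrix
open scoped Matrix.Norms.L2Operator

namespace StrongDetect

/-! Matrices carry the operator norm induced by the Euclidean norm, vectors the Euclidean norm.
Time functions are functions on `ℝ` of which only the values on `J = [0, ∞)` are used. -/

/-! ### Moore-Penrose pseudoinverse -/

/-- The four Penrose equations (real matrices). -/
structure IsMoorePenrose {m n : Type*} [Fintype m] [Fintype n]
    (M : Matrix m n ℝ) (X : Matrix n m ℝ) : Prop where
  mul_mul_self : M * X * M = M
  mul_mul_inv : X * M * X = X
  symm_left : (M * X)ᵀ = M * X
  symm_right : (X * M)ᵀ = X * M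

theorem exists_isMoorePenrose {m n : Type*} [Fintype m] [Fintype n] [DecidableEq n]
    (M : Matrix m n ℝ) : ∃ X : Matrix n m ℝ, IsMoorePenrose M X := by
  obtain ⟨G, hG, h1, h2, h3⟩ : ∃ G : Matrix n n ℝ, Gᵀ = G ∧
      (Mᵀ * M) * G * (Mᵀ * M) = Mᵀ * M ∧ G * (Mᵀ * M) * G = G ∧
      (Mᵀ * M) * G = G * (Mᵀ * M) := by
    have hH : (Mᵀ * M).IsHermitian := by
      rw [Matrix.IsHermitian, conjTranspose_eq_transpose_of_trivial, transpose_mul,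
        transpose_transpose]
    obtain ⟨U, V, d, hVU, hVt, hE⟩ : ∃ (U V : Matrix n n ℝ) (d : n → ℝ), V * U = 1 ∧ Uᵀ = V ∧
        Mᵀ * M = U * diagonal d * V := by
      refine ⟨hH.eigenvectorUnitary, star (hH.eigenvectorUnitary : Matrix n n ℝ),
        hH.eigenvalues, ?_, ?_, ?_⟩
      · exact Unitary.coe_star_mul_self hH.eigenvectorUnitary
      · rw [star_eq_conjTranspose, conjTranspose_eq_transpose_of_trivial]
      · have := hH.spectral_theorem
        rw [Unitary.conjStarAlgAut_apply] at this
        exact this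
    have hUt : Vᵀ = U := by rw [← hVt, transpose_transpose]
    have key : ∀ a b : n → ℝ, (U * diagonal a * V) * (U * diagonal b * V)
        = U * diagonal (fun i => a i * b i) * V := by
      intro a b
      calc (U * diagonal a * V) * (U * diagonal b * V)
          = U * diagonal a * (V * U) * diagonal b * V := by simp only [Matrix.mul_assoc]
        _ = _ := by rw [hVU, Matrix.mul_one, Matrix.mul_assoc U, diagonal_mul_diagonal]
    refine ⟨U * diagonal (fun i => (d i)⁻¹) * V, ?_, ?_, ?_, ?_⟩
    · rw [transpose_mul, transpose_mul, diagonal_transpose, hVt, hUt, Matrix.mul_assoc]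
    · rw [hE, key, key]
      simp
    · rw [hE, key, key]
      congr 3
      funext i
      by_cases h : d i = 0 <;> simp [h]
    · rw [hE, key, key]
      simp only [mul_comm]
  refine ⟨G * Mᵀ, ?_, ?_, ?_, ?_⟩
  · have h0 : (M * (G * (Mᵀ * M) - 1))ᴴ * (M * (G * (Mᵀ * M) - 1)) = 0 := by
      have e : M.transpose * M * (G * (Mᵀ * M) - 1) = 0 := by
        rw [Matrix.mul_sub, Matrix.mul_one, ← Matrix.mul_assoc, h1, sub_self]
      rw [conjTranspose_eq_transpose_of_trivial, transpose_mul, Matrix.mul_assoc,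
        ← Matrix.mul_assoc Mᵀ, e, Matrix.mul_zero]
    have h4 := conjTranspose_mul_self_eq_zero.1 h0
    rw [Matrix.mul_sub, Matrix.mul_one, sub_eq_zero] at h4
    simpa only [Matrix.mul_assoc] using h4
  · calc G * Mᵀ * M * (G * Mᵀ) = G * (Mᵀ * M) * G * Mᵀ := by simp only [Matrix.mul_assoc]
      _ = _ := by rw [h2]
  · rw [transpose_mul, transpose_mul, transpose_transpose, hG, Matrix.mul_assoc]
  · rw [Matrix.mul_assoc, transpose_mul, hG, transpose_mul, transpose_transpose, h3]

theorem IsMoorePenrose.unique {m n : Type*} [Fintype m] [Fintype n]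
    {M : Matrix m n ℝ} {X Y : Matrix n m ℝ}
    (hX : IsMoorePenrose M X) (hY : IsMoorePenrose M Y) : X = Y := by
  have a : M * X = M * Y := by
    calc M * X = (M * X)ᵀ := hX.symm_left.symm
      _ = ((M * Y) * (M * X))ᵀ := by rw [← Matrix.mul_assoc, hY.mul_mul_self]
      _ = (M * X) * (M * Y) := by rw [transpose_mul, hX.symm_left, hY.symm_left]
      _ = M * Y := by rw [← Matrix.mul_assoc, hX.mul_mul_self]
  have b : X * M = Y * M := by
    calc X * M = (X * M)ᵀ := hX.symm_right.symm
      _ = ((X * M) * (Y * M))ᵀ := by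
          rw [Matrix.mul_assoc, ← Matrix.mul_assoc M, hY.mul_mul_self]
      _ = (Y * M) * (X * M) := by rw [transpose_mul, hX.symm_right, hY.symm_right]
      _ = Y * M := by rw [Matrix.mul_assoc, ← Matrix.mul_assoc M, hX.mul_mul_self]
  calc X = X * M * X := hX.mul_mul_inv.symm
    _ = Y * M * Y := by rw [b, Matrix.mul_assoc, a, ← Matrix.mul_assoc]
    _ = Y := hY.mul_mul_inv

/-- The Moore-Penrose pseudoinverse: the unique matrix satisfying the Penrose equations. -/
noncomputable def pinv {m n : ℕ} (M : Matrix (Fin m) (Fin n) ℝ) : Matrix (Fin n) (Fin m) ℝ :=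
  Classical.choose (exists_isMoorePenrose M)

theorem pinv_spec {m n : ℕ} (M : Matrix (Fin m) (Fin n) ℝ) : IsMoorePenrose M (pinv M) :=
  Classical.choose_spec (exists_isMoorePenrose M)

/-! ### Time functions and differential equations on `J = [0, ∞)` -/

/-- Uniform boundedness on `J`. -/
def UniformlyBounded {E : Type*} [Norm E] (F : ℝ → E) : Prop :=
  ∃ K : ℝ, ∀ t : ℝ, 0 ≤ t → ‖F t‖ ≤ K

/-- The time derivative on `J` (one-sided at `0`). -/
noncomputable def dot {m n : ℕ} (F : ℝ → Matrix (Fin m) (Fin n) ℝ) :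
    ℝ → Matrix (Fin m) (Fin n) ℝ :=
  fun t => derivWithin F (Ici 0) t

/-- Entrywise measurability of a matrix-valued function of time. -/
def MeasurableMatrix {m n : Type*} (F : ℝ → Matrix m n ℝ) : Prop :=
  ∀ i j, Measurable fun t => F t i j

/-- `x` is a (Carathéodory) solution of `ẋ = f(t, x)` on `J`: it satisfies the integral equation
with a locally integrable right-hand side; equivalently, it is locally absolutely continuous on `J`
and satisfies the differential equation almost everywhere. -/
def IsSolution {E : Type*} [NormedAddCommGroup E] [NormedSpace ℝ E]
    (f : ℝ → E → E) (x : ℝ → E) : Prop :=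
  ∀ t : ℝ, 0 ≤ t → IntervalIntegrable (fun s => f s (x s)) volume 0 t ∧
    x t = x 0 + ∫ s in (0 : ℝ)..t, f s (x s)

/-- `‖e(t)‖ ≤ M e^{-μ (t - t₀)} ‖e(t₀)‖` for all `t ≥ t₀ ≥ 0`. -/
def ExpBound {E : Type*} [Norm E] (M μ : ℝ) (e : ℝ → E) : Prop :=
  ∀ t₀ t : ℝ, 0 ≤ t₀ → t₀ ≤ t → ‖e t‖ ≤ M * Real.exp (-μ * (t - t₀)) * ‖e t₀‖

/-- Uniform exponential stability of `ẋ = F(t) x`. -/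
def UES {n : ℕ} (F : ℝ → Matrix (Fin n) (Fin n) ℝ) : Prop :=
  ∃ M μ : ℝ, 0 < M ∧ 0 < μ ∧ ∀ x : ℝ → EuclideanSpace ℝ (Fin n),
    IsSolution (fun t v => toEuclideanLin (F t) v) x → ExpBound M μ x

/-- Uniform exponential detectability of the pair `(A(t), C(t))`. -/
def UniformlyExponentiallyDetectable {n : ℕ} {m : Type*} [Fintype m] [DecidableEq m]
    (A : ℝ → Matrix (Fin n) (Fin n) ℝ) (C : ℝ → Matrix m (Fin n) ℝ) : Prop :=
  ∃ L : ℝ → Matrix (Fin n) m ℝ, MeasurableMatrix L ∧ UniformlyBounded L ∧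
    UES fun t => A t - L t * C t

/-- The observer `ż = N(t) z + R(t) y`, `x̂ = z + S(t) y` is a strong observer for
`ẋ = A(t) x + D(t) w`, `y = C(t) x`. The unknown input `w` is an arbitrary locally integrable
function, and the constants in the error bound do not depend on `w` or on the initial states. -/
def IsStrongObserver {n p q : ℕ}
    (A : ℝ → Matrix (Fin n) (Fin n) ℝ) (D : ℝ → Matrix (Fin n) (Fin q) ℝ)
    (C : ℝ → Matrix (Fin p) (Fin n) ℝ)
    (N : ℝ → Matrix (Fin n) (Fin n) ℝ) (R S : ℝ → Matrix (Fin n) (Fin p) ℝ) : Prop :=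
  ∃ M μ : ℝ, 0 < M ∧ 0 < μ ∧
    ∀ (w : ℝ → EuclideanSpace ℝ (Fin q)) (x z : ℝ → EuclideanSpace ℝ (Fin n))
      (y : ℝ → EuclideanSpace ℝ (Fin p)) (xhat : ℝ → EuclideanSpace ℝ (Fin n)),
      LocallyIntegrableOn w (Ici 0) →
      IsSolution (fun t v => toEuclideanLin (A t) v + toEuclideanLin (D t) (w t)) x →
      (∀ t, 0 ≤ t → y t = toEuclideanLin (C t) (x t)) →
      IsSolution (fun t v => toEuclideanLin (N t) v + toEuclideanLin (R t) (y t)) z →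
      (∀ t, 0 ≤ t → xhat t = z t + toEuclideanLin (S t) (y t)) →
      ExpBound M μ (fun t => x t - xhat t)

/-- Uniform strong* detectability: a strong observer exists. -/
def UniformlyStrongStarDetectable {n p q : ℕ}
    (A : ℝ → Matrix (Fin n) (Fin n) ℝ) (D : ℝ → Matrix (Fin n) (Fin q) ℝ)
    (C : ℝ → Matrix (Fin p) (Fin n) ℝ) : Prop :=
  ∃ (N : ℝ → Matrix (Fin n) (Fin n) ℝ) (R S : ℝ → Matrix (Fin n) (Fin p) ℝ),
    MeasurableMatrix N ∧ UniformlyBounded N ∧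
    MeasurableMatrix R ∧ UniformlyBounded R ∧
    UniformlyBounded S ∧ (∃ K, LipschitzOnWith K S (Ici 0)) ∧
    IsStrongObserver A D C N R S

/-- `Ã = A - D Γ† (C A + Ċ)` with `Γ = C D`. -/
noncomputable def auxA {n p q : ℕ}
    (A : ℝ → Matrix (Fin n) (Fin n) ℝ) (D : ℝ → Matrix (Fin n) (Fin q) ℝ)
    (C : ℝ → Matrix (Fin p) (Fin n) ℝ) : ℝ → Matrix (Fin n) (Fin n) ℝ :=
  fun t => A t - D t * pinv (C t * D t) * (C t * A t + dot C t)

/-- `C̃ = [C; C Ã + Ċ]`. -/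
noncomputable def auxC {n p q : ℕ}
    (A : ℝ → Matrix (Fin n) (Fin n) ℝ) (D : ℝ → Matrix (Fin n) (Fin q) ℝ)
    (C : ℝ → Matrix (Fin p) (Fin n) ℝ) : ℝ → Matrix (Fin p ⊕ Fin p) (Fin n) ℝ :=
  fun t => fromRows (C t) (C t * auxA A D C t + dot C t)

end StrongDetect

/-! Put `T = 1 - S C`, `Γ = C D`, and `C₂ = C Ã + Ċ = (1 - Γ Γ†)(C A + Ċ)`. Since `S` is Lipschitz,
the error `e = T x - z` is locally absolutely continuous and satisfies `ė = P x + T D w + N e` with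
`P = Ṫ + T A - R C - N T`. The theorem amounts to making `P` and `T D` vanish while `N` stays
exponentially stable.

Strong* detectability implies detectability: an observer started with zero error keeps zero error by
the exponential bound, so `P x + T D w` integrates to zero along every trajectory. Trajectories with
constant input pass through every state at every time, hence `P = 0` and `T D = 0` almost everywhere
(`ae_eq_zero_of_curves`, `IsStrongObserver.ae_decoupled`). By algebra these identities say `N = Ã -
L C̃` with `L = [R + Ṡ - N S, S]` (`observer_matrix_eq`). Feeding the observer zero input and zero
state shows that `N` is stable.

Conversely, for a stabilizing `L = [L₁, L₂]`, the algebra suggests `S = D Γ† + L₂ (1 - Γ Γ†)`, but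
`L₂` is only bounded and measurable, whereas `S` has to be Lipschitz. So `L₂` is replaced by a
moving average `Y`, for which `L₂ - Y` is the derivative of a uniformly small function
(`BddMeas.exists_smoothing`). As `C₂` is Lipschitz, this fast perturbation has little effect over
any fixed window, and stability survives (`UES.exists_averaging`). Then `N = Ã - L₁ C - Y C₂` and `R
= L₁ + N S - Ṡ` give an observer (`decoupling`, `error_equation`). -/

namespace StrongDetect

open Filter Topology

/-! ### Calculus of indefinite integrals on `J`. -/

section Primitive

variable {E F G : Type*} [NormedAddCommGroup E] [NormedSpace ℝ E] [NormedAddCommGroup F]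
  [NormedSpace ℝ F] [NormedAddCommGroup G] [NormedSpace ℝ G]

/-- `X` is an indefinite integral of `f` on `J = [0, ∞)`. -/
def IsPrimitive (X f : ℝ → E) : Prop :=
  ∀ t : ℝ, 0 ≤ t → IntervalIntegrable f volume 0 t ∧ X t = X 0 + ∫ s in (0 : ℝ)..t, f s

namespace IsPrimitive

theorem intervalIntegrable {X f : ℝ → E} (h : IsPrimitive X f) {a b : ℝ} (ha : 0 ≤ a)
    (hb : 0 ≤ b) : IntervalIntegrable f volume a b :=
  (h a ha).1.symm.trans (h b hb).1

theorem sub_eq {X f : ℝ → E} (h : IsPrimitive X f) {a b : ℝ} (ha : 0 ≤ a) (hb : 0 ≤ b) :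
    X b - X a = ∫ s in a..b, f s := by
  rw [(h a ha).2, (h b hb).2, ← intervalIntegral.integral_interval_sub_left (h b hb).1 (h a ha).1]
  abel

theorem continuousOn {X f : ℝ → E} (h : IsPrimitive X f) : ContinuousOn X (Ici 0) := by
  intro t ht
  have h1 : ContinuousOn (fun u => X 0 + ∫ s in (0 : ℝ)..u, f s) (Icc 0 (t + 1)) := by
    refine continuousOn_const.add ?_
    have ht1 : (0 : ℝ) ≤ t + 1 := by linarith [mem_Ici.1 ht]
    have := intervalIntegral.continuousOn_primitive_interval' (h (t + 1) ht1).1 (left_mem_uIcc)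
    rwa [uIcc_of_le ht1] at this
  have h2 : ContinuousOn X (Icc 0 (t + 1)) := h1.congr fun u hu => (h u hu.1).2
  refine (h2 t ⟨ht, by linarith⟩).mono_of_mem_nhdsWithin ?_
  have : Iic (t + 1) ∈ 𝓝 t := Iic_mem_nhds (by linarith)
  rw [← Ici_inter_Iic]
  exact inter_mem self_mem_nhdsWithin (mem_nhdsWithin_of_mem_nhds this)

theorem add {X Y f g : ℝ → E} (hX : IsPrimitive X f) (hY : IsPrimitive Y g) :
    IsPrimitive (fun t => X t + Y t) (fun t => f t + g t) := fun t ht => by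
  refine ⟨(hX t ht).1.add (hY t ht).1, ?_⟩
  simp only
  rw [intervalIntegral.integral_add (hX t ht).1 (hY t ht).1, (hX t ht).2, (hY t ht).2]
  abel

theorem sub {X Y f g : ℝ → E} (hX : IsPrimitive X f) (hY : IsPrimitive Y g) :
    IsPrimitive (fun t => X t - Y t) (fun t => f t - g t) := fun t ht => by
  refine ⟨(hX t ht).1.sub (hY t ht).1, ?_⟩
  simp only
  rw [intervalIntegral.integral_sub (hX t ht).1 (hY t ht).1, (hX t ht).2, (hY t ht).2]
  abel

theorem const (c : E) : IsPrimitive (fun _ => c) (fun _ => (0 : E)) := fun t _ => by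
  simp

theorem sum {ι : Type*} (s : Finset ι) {X f : ι → ℝ → E} (h : ∀ i, IsPrimitive (X i) (f i)) :
    IsPrimitive (fun t => ∑ i ∈ s, X i t) (fun t => ∑ i ∈ s, f i t) := by
  classical
  induction s using Finset.induction_on with
  | empty => simpa using const (0 : E)
  | insert i s hi ih =>
    simp only [Finset.sum_insert hi]
    exact (h i).add ih

theorem clm [CompleteSpace E] [CompleteSpace F] (L : E →L[ℝ] F) {X f : ℝ → E}
    (h : IsPrimitive X f) :
    IsPrimitive (fun t => L (X t)) (fun t => L (f t)) := fun t ht => by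
  refine ⟨⟨L.integrable_comp (h t ht).1.1, L.integrable_comp (h t ht).1.2⟩, ?_⟩
  simp only
  rw [L.intervalIntegral_comp_comm (h t ht).1, (h t ht).2, map_add]

theorem congr {X Y f g : ℝ → E} (h : IsPrimitive X f) (hXY : ∀ t, 0 ≤ t → X t = Y t)
    (hfg : ∀ᵐ t, 0 ≤ t → f t = g t) : IsPrimitive Y g := fun t ht => by
  have h0 : ∀ᵐ s, s ∈ uIoc 0 t → f s = g s := by
    filter_upwards [hfg] with s hs hst
    rw [uIoc_of_le ht] at hst
    exact hs hst.1.le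
  refine ⟨(h t ht).1.congr_ae ?_, ?_⟩
  · exact (ae_restrict_iff' measurableSet_uIoc).2 h0
  · rw [← hXY t ht, ← hXY 0 le_rfl, (h t ht).2, intervalIntegral.integral_congr_ae h0]

/-- Integration by parts for absolutely continuous functions; the derivatives of the integral
representations agree with `f` and `g` almost everywhere by Lebesgue differentiation. -/
theorem mul {X Y f g : ℝ → ℝ} (hX : IsPrimitive X f) (hY : IsPrimitive Y g) :
    IsPrimitive (fun t => X t * Y t) (fun t => f t * Y t + X t * g t) := fun t ht => by
  have cX : ContinuousOn X (uIcc 0 t) := hX.continuousOn.mono (by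
    rw [uIcc_of_le ht]; exact Icc_subset_Ici_self)
  have cY : ContinuousOn Y (uIcc 0 t) := hY.continuousOn.mono (by
    rw [uIcc_of_le ht]; exact Icc_subset_Ici_self)
  refine ⟨((hX t ht).1.mul_continuousOn cY).add ((hY t ht).1.continuousOn_mul cX), ?_⟩
  have ac : ∀ {Z h : ℝ → ℝ}, IsPrimitive Z h →
      AbsolutelyContinuousOnInterval (fun u => Z 0 + ∫ s in (0 : ℝ)..u, h s) 0 t := fun {Z h} hZ =>
    (((LipschitzWith.const (Z 0)).lipschitzOnWith (s := uIcc 0 t)).absolutelyContinuousOnInterval).add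
      ((hZ t ht).1.absolutelyContinuousOnInterval_intervalIntegral (c := 0) (by simp))
  have key := (ac hX).integral_deriv_mul_eq_sub (ac hY)
  have e : ∀ᵐ s, s ∈ uIoc 0 t → deriv (fun u => X 0 + ∫ s in (0 : ℝ)..u, f s) s *
      (Y 0 + ∫ s in (0 : ℝ)..s, g s) + (X 0 + ∫ s in (0 : ℝ)..s, f s) *
      deriv (fun u => Y 0 + ∫ s in (0 : ℝ)..u, g s) s = f s * Y s + X s * g s := by
    filter_upwards [(hX t ht).1.ae_hasDerivAt_integral, (hY t ht).1.ae_hasDerivAt_integral]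
      with s h1 h2 hs
    have hs' := uIoc_subset_uIcc hs
    rw [((h1 hs' 0 (by simp)).const_add (X 0)).deriv, ((h2 hs' 0 (by simp)).const_add (Y 0)).deriv]
    rw [uIoc_of_le ht] at hs
    rw [← (hX s hs.1.le).2, ← (hY s hs.1.le).2]
  rw [intervalIntegral.integral_congr_ae e] at key
  rw [key]
  simp [← (hX t ht).2, ← (hY t ht).2]

/-- In bases, a bilinear map is a finite sum of products of coordinates, so the scalar product rule
suffices. -/
theorem bilin [FiniteDimensional ℝ E] [FiniteDimensional ℝ F] [CompleteSpace G]
    (B : E →ₗ[ℝ] F →ₗ[ℝ] G) {X f : ℝ → E} {Y g : ℝ → F} (hX : IsPrimitive X f)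
    (hY : IsPrimitive Y g) :
    IsPrimitive (fun t => B (X t) (Y t)) (fun t => B (f t) (Y t) + B (X t) (g t)) := by
  have : CompleteSpace E := FiniteDimensional.complete ℝ E
  have : CompleteSpace F := FiniteDimensional.complete ℝ F
  let b := Module.finBasis ℝ E
  let c := Module.finBasis ℝ F
  have expand : ∀ x y, B x y = ∑ i, ∑ j, (b.coord i x * c.coord j y) • B (b i) (c j) := by
    intro x y
    conv_lhs => rw [← b.sum_repr x, ← c.sum_repr y]
    simp only [map_sum, map_smul, LinearMap.sum_apply, LinearMap.smul_apply, Finset.smul_sum,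
      smul_smul, Module.Basis.coord_apply]
    rw [Finset.sum_comm]
    simp only [mul_comm]
  have main : IsPrimitive
      (fun t => ∑ i, ∑ j, (b.coord i (X t) * c.coord j (Y t)) • B (b i) (c j))
      (fun t => ∑ i, ∑ j, (b.coord i (f t) * c.coord j (Y t) + b.coord i (X t) * c.coord j (g t)) •
        B (b i) (c j)) := by
    refine IsPrimitive.sum _ fun i => IsPrimitive.sum _ fun j => ?_
    exact ((hX.clm (LinearMap.toContinuousLinearMap (b.coord i))).mul
      (hY.clm (LinearMap.toContinuousLinearMap (c.coord j)))).clm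
      ((ContinuousLinearMap.id ℝ ℝ).smulRight (B (b i) (c j)))
  refine main.congr (fun t _ => (expand _ _).symm) (Eventually.of_forall fun t _ => ?_)
  rw [expand (f t), expand (X t)]
  simp only [← Finset.sum_add_distrib, add_smul]

/-- A Lipschitz function on `J` is an indefinite integral of a bounded measurable function. -/
theorem exists_of_lipschitz [FiniteDimensional ℝ E] {X : ℝ → E} {K : NNReal}
    (hX : LipschitzOnWith K X (Ici 0)) :
    ∃ f : ℝ → E, StronglyMeasurable f ∧ (∀ t, ‖f t‖ ≤ K) ∧ IsPrimitive X f := by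
  have : CompleteSpace E := FiniteDimensional.complete ℝ E
  -- The constant extension to negative times is Lipschitz on the whole line. Its `deriv` is bounded
  -- by `K` everywhere, being zero where differentiability fails.
  have hY : LipschitzWith K (fun t => X (max t 0)) := by
    rw [← lipschitzOnWith_univ]
    have := hX.comp (f := fun t : ℝ => max t 0) (s := univ)
      ((LipschitzWith.id.max_const 0).lipschitzOnWith) (fun t _ => le_max_right t 0)
    rwa [mul_one] at this
  have hfm : StronglyMeasurable (deriv fun t => X (max t 0)) := stronglyMeasurable_deriv _
  have hfb : ∀ t, ‖deriv (fun t => X (max t 0)) t‖ ≤ K := fun t => norm_deriv_le_of_lipschitz hY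
  have hint : ∀ a b, IntervalIntegrable (deriv fun t => X (max t 0)) volume a b := fun a b =>
    (intervalIntegrable_const (c := (K : ℝ))).mono_fun hfm.aestronglyMeasurable
      (Eventually.of_forall fun t => by simpa using hfb t)
  refine ⟨_, hfm, hfb, fun t ht => ⟨hint _ _, ?_⟩⟩
  let b := Module.finBasis ℝ E
  refine b.ext_elem fun i => ?_
  let ℓ := LinearMap.toContinuousLinearMap (b.coord i)
  change ℓ (X t) = ℓ (X 0 + _)
  rw [map_add, ← ℓ.intervalIntegral_comp_comm (hint 0 t)]
  have h1 : LipschitzWith (‖ℓ‖₊ * K) (fun t => ℓ (X (max t 0))) := ℓ.lipschitz.comp hY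
  have h2 := (h1.lipschitzOnWith (s := uIcc 0 t)).absolutelyContinuousOnInterval.integral_deriv_eq_sub
  have h3 : ∀ᵐ s, s ∈ uIoc 0 t → ℓ (deriv (fun t => X (max t 0)) s) =
      deriv (fun t => ℓ (X (max t 0))) s := by
    filter_upwards [hY.ae_differentiableAt_real] with s hs _
    exact ((ℓ.hasFDerivAt.comp_hasDerivAt s hs.hasDerivAt).deriv).symm
  rw [intervalIntegral.integral_congr_ae h3, h2]
  simp [ht]

/-- If all increments of an indefinite integral vanish, so does the integrand. -/
theorem ae_eq_zero [CompleteSpace E] {X f : ℝ → E} (h : IsPrimitive X f)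
    (hX : ∀ t, 0 ≤ t → X t = X 0) : ∀ᵐ t, 0 ≤ t → f t = 0 := by
  have h1 : ∀ n : ℕ, ∀ᵐ t, t ∈ Ioo (0 : ℝ) n → f t = 0 := by
    intro n
    have hn : (0 : ℝ) ≤ n := n.cast_nonneg
    filter_upwards [(h n hn).1.ae_hasDerivAt_integral] with t ht htn
    have h2 := ht (by rw [uIcc_of_le hn]; exact ⟨htn.1.le, htn.2.le⟩) 0 (by simp)
    have h3 : HasDerivAt (fun u => ∫ s in (0 : ℝ)..u, f s) 0 t := by
      refine (hasDerivAt_const t (0 : E)).congr_of_eventuallyEq ?_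
      filter_upwards [Ioi_mem_nhds htn.1] with u hu
      have := (h u (le_of_lt hu)).2
      rw [hX u (le_of_lt hu)] at this
      simpa using this
    exact h2.unique h3
  have h0 : ∀ᵐ t : ℝ, t ≠ 0 := by simp [ae_iff, measure_singleton]
  filter_upwards [ae_all_iff.2 h1, h0] with t ht ht0 htp
  obtain ⟨n, hn⟩ := exists_nat_gt t
  exact ht n ⟨lt_of_le_of_ne htp (Ne.symm ht0), hn⟩

/-- A differentiable function on `J` with continuous derivative is an indefinite integral of it. -/
theorem of_derivWithin [CompleteSpace E] {X : ℝ → E} (hX : DifferentiableOn ℝ X (Ici 0))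
    (hc : ContinuousOn (fun t => derivWithin X (Ici 0) t) (Ici 0)) :
    IsPrimitive X (fun t => derivWithin X (Ici 0) t) := fun t ht => by
  have hs : uIcc 0 t ⊆ Ici 0 := by rw [uIcc_of_le ht]; exact Icc_subset_Ici_self
  have hi : IntervalIntegrable (fun t => derivWithin X (Ici 0) t) volume 0 t :=
    (hc.mono hs).intervalIntegrable
  refine ⟨hi, ?_⟩
  rw [intervalIntegral.integral_eq_sub_of_hasDerivAt_of_le ht
    (hX.continuousOn.mono Icc_subset_Ici_self) (fun s hs => ?_) hi]
  · abel
  · exact (hX s hs.1.le).hasDerivWithinAt.hasDerivAt (Ici_mem_nhds hs.1)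

end IsPrimitive

end Primitive

/-! ### Global existence for Carathéodory equations. -/

theorem abs_integral_exp_abs_le {a : ℝ} (ha : 0 < a) (t : ℝ) :
    |∫ s in (0 : ℝ)..t, Real.exp (a * |s|)| ≤ Real.exp (a * |t|) / a := by
  have pos : ∀ t : ℝ, 0 ≤ t → |∫ s in (0 : ℝ)..t, Real.exp (a * |s|)| ≤ Real.exp (a * |t|) / a := by
    intro t ht
    have h : ∀ s ∈ uIcc 0 t, HasDerivAt (fun u => Real.exp (a * u) / a) (Real.exp (a * |s|)) s := by
      intro s hs
      rw [uIcc_of_le ht] at hs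
      rw [abs_of_nonneg hs.1]
      have := (((hasDerivAt_id s).const_mul a).exp).div_const a
      simpa [ha.ne'] using this
    rw [intervalIntegral.integral_eq_sub_of_hasDerivAt h
      (Continuous.intervalIntegrable (by fun_prop) _ _), abs_of_nonneg ht, abs_of_nonneg]
    · simp only [mul_zero, Real.exp_zero]
      have : 0 < 1 / a := by positivity
      linarith
    · rw [sub_nonneg]
      gcongr
  rcases le_total 0 t with ht | ht
  · exact pos t ht
  · have h := pos (-t) (by linarith)
    have e := intervalIntegral.integral_comp_neg (a := 0) (b := t)
      (fun s : ℝ => Real.exp (a * |s|))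
    simp only [abs_neg, neg_zero] at e h
    rw [e, intervalIntegral.integral_symm, abs_neg]
    exact h

section Caratheodory

variable {E : Type*} [NormedAddCommGroup E] [NormedSpace ℝ E]

theorem norm_integral_le_of_le_exp_abs {a c : ℝ} (ha : 0 < a) (hc : 0 ≤ c)
    {g : ℝ → E} (hg : ∀ s, ‖g s‖ ≤ c * Real.exp (a * |s|)) (t : ℝ) :
    ‖∫ s in (0 : ℝ)..t, g s‖ ≤ c * (Real.exp (a * |t|) / a) := by
  have h := intervalIntegral.norm_integral_le_abs_of_norm_le (a := 0) (b := t) (μ := volume)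
    (f := g) (Eventually.of_forall hg) (Continuous.intervalIntegrable (by fun_prop) _ _)
  rw [intervalIntegral.integral_const_mul, abs_mul, abs_of_nonneg hc] at h
  exact h.trans (by gcongr; exact abs_integral_exp_abs_le ha t)

/-- Global existence for Carathéodory equations with a uniformly Lipschitz right-hand side,
started at time `0`. -/
theorem exists_integral_solution_zero [CompleteSpace E] (f : ℝ → E → E) {K : ℝ}
    (hmeas : ∀ x : ℝ → E, Continuous x → AEStronglyMeasurable (fun t => f t (x t)) volume)
    (hlip : ∀ t u v, ‖f t u - f t v‖ ≤ K * ‖u - v‖) (h0 : ∀ t, ‖f t 0‖ ≤ K) (v : E) :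
    ∃ x : ℝ → E, Continuous x ∧ ∀ t, x t = v + ∫ s in (0 : ℝ)..t, f s (x s) := by
  wlog hK : 1 ≤ K generalizing K
  · push Not at hK
    exact this (K := 1) (fun t u v => (hlip t u v).trans (by gcongr))
      (fun t => (h0 t).trans hK.le) le_rfl
  have ha : 0 < 2 * K := by linarith
  -- Bielecki weight: writing `x = ω y` with `y` bounded, the Picard map contracts by `K / (2 K) = 1
  -- / 2` on all of `ℝ` at once.
  let ω : ℝ → ℝ := fun t => Real.exp (2 * K * |t|)
  have hω : Continuous ω := by fun_prop
  have hω1 : ∀ t, 1 ≤ ω t := fun t => Real.one_le_exp (by positivity)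
  have hωpos : ∀ t, 0 < ω t := fun t => Real.exp_pos _
  have hgrow : ∀ (y : BoundedContinuousFunction ℝ E) s,
      ‖f s (ω s • y s)‖ ≤ K * (1 + ‖y‖) * ω s := by
    intro y s
    have h1 := hlip s (ω s • y s) 0
    have h2 : ‖f s (ω s • y s)‖ ≤ ‖f s (ω s • y s) - f s 0‖ + ‖f s 0‖ := by
      simpa using norm_add_le (f s (ω s • y s) - f s 0) (f s 0)
    rw [sub_zero, norm_smul, Real.norm_of_nonneg (hωpos s).le] at h1
    have h3 : ω s * ‖y s‖ ≤ ω s * ‖y‖ := by gcongr; exact y.norm_coe_le_norm s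
    have h4 : K * (ω s * ‖y s‖) ≤ K * (ω s * ‖y‖) := by gcongr
    have h5 : K ≤ K * ω s := by nlinarith [hω1 s]
    linarith [h0 s]
  have hint : ∀ (y : BoundedContinuousFunction ℝ E) a b,
      IntervalIntegrable (fun s => f s (ω s • y s)) volume a b := by
    intro y a b
    have h1 : IntervalIntegrable (fun s => K * (1 + ‖y‖) * ω s) volume a b :=
      Continuous.intervalIntegrable (by fun_prop) _ _
    refine h1.mono_fun (hmeas _ (by fun_prop)).restrict (Eventually.of_forall fun s => ?_)
    exact (hgrow y s).trans (le_abs_self _)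
  let Φ : BoundedContinuousFunction ℝ E → BoundedContinuousFunction ℝ E := fun y =>
    BoundedContinuousFunction.ofNormedAddCommGroup
      (fun t => (ω t)⁻¹ • (v + ∫ s in (0 : ℝ)..t, f s (ω s • y s)))
      ((hω.inv₀ fun t => (hωpos t).ne').smul
        (continuous_const.add (intervalIntegral.continuous_primitive (hint y) 0)))
      (‖v‖ + K * (1 + ‖y‖) / (2 * K)) (fun t => by
        rw [norm_smul, norm_inv, Real.norm_of_nonneg (hωpos t).le, inv_mul_le_iff₀ (hωpos t)]
        refine (norm_add_le _ _).trans ?_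
        have h1 := norm_integral_le_of_le_exp_abs ha (by positivity) (hgrow y) t
        have h2 : ‖v‖ ≤ ω t * ‖v‖ := le_mul_of_one_le_left (norm_nonneg _) (hω1 t)
        calc _ ≤ ω t * ‖v‖ + K * (1 + ‖y‖) * (ω t / (2 * K)) := add_le_add h2 h1
          _ = _ := by ring)
  have hcontr : ContractingWith (1 / 2) Φ := by
    refine ⟨by rw [div_lt_one] <;> norm_num, LipschitzWith.of_dist_le_mul fun y z => ?_⟩
    rw [BoundedContinuousFunction.dist_le (by positivity)]
    intro t
    rw [dist_eq_norm, dist_eq_norm]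
    change ‖(ω t)⁻¹ • (v + ∫ s in (0 : ℝ)..t, f s (ω s • y s)) -
      (ω t)⁻¹ • (v + ∫ s in (0 : ℝ)..t, f s (ω s • z s))‖ ≤ _
    rw [← smul_sub, add_sub_add_left_eq_sub, ← intervalIntegral.integral_sub (hint y _ _)
      (hint z _ _), norm_smul, norm_inv, Real.norm_of_nonneg (hωpos t).le,
      inv_mul_le_iff₀ (hωpos t)]
    have hb : ∀ s, ‖f s (ω s • y s) - f s (ω s • z s)‖ ≤ K * ‖y - z‖ * ω s := by
      intro s
      refine (hlip s _ _).trans ?_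
      rw [← smul_sub, norm_smul, Real.norm_of_nonneg (hωpos s).le]
      have : ‖y s - z s‖ ≤ ‖y - z‖ := (y - z).norm_coe_le_norm s
      calc K * (ω s * ‖y s - z s‖) ≤ K * (ω s * ‖y - z‖) := by
            have := hωpos s
            gcongr
        _ = _ := by ring
    refine (norm_integral_le_of_le_exp_abs ha (by positivity) hb t).trans (le_of_eq ?_)
    change K * ‖y - z‖ * (ω t / (2 * K)) = _
    push_cast
    field_simp
  have hfix := hcontr.fixedPoint_isFixedPt
  set y := hcontr.fixedPoint Φ with hy
  refine ⟨fun t => ω t • y t, by fun_prop, fun t => ?_⟩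
  have h1 : y t = (ω t)⁻¹ • (v + ∫ s in (0 : ℝ)..t, f s (ω s • y s)) := by
    conv_lhs => rw [← hfix]
    rfl
  simp only
  conv_lhs => rw [h1]
  rw [smul_inv_smul₀ (hωpos t).ne']

/-- Global existence for Carathéodory equations on `J` with a uniformly Lipschitz right-hand side
and with prescribed value at an arbitrary time. -/
theorem exists_isSolution [CompleteSpace E] (f : ℝ → E → E) {K : ℝ}
    (hmeas : ∀ x : ℝ → E, ContinuousOn x (Ici 0) →
      AEStronglyMeasurable (fun t => f t (x t)) (volume.restrict (Ici 0)))
    (hlip : ∀ t, 0 ≤ t → ∀ u v, ‖f t u - f t v‖ ≤ K * ‖u - v‖)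
    (h0 : ∀ t, 0 ≤ t → ‖f t 0‖ ≤ K) (s : ℝ) (v : E) :
    ∃ x : ℝ → E, x s = v ∧ IsSolution f x := by
  classical
  have hK : 0 ≤ K := (norm_nonneg _).trans (h0 0 le_rfl)
  -- Time is shifted so that the prescribed value sits at `0`, and the field is cut off outside `J`;
  -- solving in both directions from `0` then covers all of `J`.
  let g : ℝ → E → E := fun t u => if 0 ≤ t + s then f (t + s) u else 0
  have gmeas : ∀ x : ℝ → E, Continuous x → AEStronglyMeasurable (fun t => g t (x t)) volume := by
    intro x hx
    have h1 := hmeas (fun t => x (t - s)) (by fun_prop)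
    rw [← aestronglyMeasurable_indicator_iff measurableSet_Ici] at h1
    have h2 := h1.comp_quasiMeasurePreserving
      (measurePreserving_add_right volume s).quasiMeasurePreserving
    refine h2.congr (Eventually.of_forall fun t => ?_)
    simp [g, Set.indicator, Function.comp]
  obtain ⟨x, hxc, hx⟩ := exists_integral_solution_zero g gmeas (K := K)
    (fun t u v => by
      by_cases h : 0 ≤ t + s
      · simpa [g, h] using hlip _ h u v
      · simp only [g, h, if_false, sub_zero, norm_zero]; positivity)
    (fun t => by
      by_cases h : 0 ≤ t + s
      · simpa [g, h] using h0 _ h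
      · simpa [g, h] using hK) v
  have hb : ∀ t, ‖g t (x t)‖ ≤ K * ‖x t‖ + K := by
    intro t
    by_cases h : 0 ≤ t + s
    · have h1 := hlip _ h (x t) 0
      have h2 : ‖f (t + s) (x t)‖ ≤ ‖f (t + s) (x t) - f (t + s) 0‖ + ‖f (t + s) 0‖ := by
        simpa using norm_add_le (f (t + s) (x t) - f (t + s) 0) (f (t + s) 0)
      simp only [g, h, if_true]
      rw [sub_zero] at h1
      linarith [h0 _ h]
    · simp only [g, h, if_false, norm_zero]; positivity
  have gint : ∀ a b, IntervalIntegrable (fun t => g t (x t)) volume a b := fun a b => by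
    have h1 : IntervalIntegrable (fun t => K * ‖x t‖ + K) volume a b :=
      Continuous.intervalIntegrable (by fun_prop) _ _
    exact h1.mono_fun (gmeas x hxc).restrict
      (Eventually.of_forall fun t => (hb t).trans (le_abs_self _))
  refine ⟨fun t => x (t - s), by simpa using hx 0, fun t ht => ?_⟩
  have e : EqOn (fun u => g (u - s) (x (u - s))) (fun u => f u (x (u - s))) (uIcc 0 t) := by
    intro u hu
    rw [uIcc_of_le ht] at hu
    simp [g, hu.1]
  have i1 : IntervalIntegrable (fun u => g (u - s) (x (u - s))) volume 0 t := by
    simpa using (gint (0 - s) (t - s)).comp_sub_right s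
  constructor
  · exact i1.congr (e.mono uIoc_subset_uIcc)
  · rw [← intervalIntegral.integral_congr e,
      intervalIntegral.integral_comp_sub_right (fun u => g u (x u))]
    simp only
    rw [hx (t - s), hx (0 - s), add_assoc, intervalIntegral.integral_add_adjacent_intervals
      (gint _ _) (gint _ _)]

end Caratheodory

/-- Grönwall's inequality in integral form. -/
theorem le_mul_exp_of_le_integral {g : ℝ → ℝ} {a b c K : ℝ} (hab : a ≤ b) (hK : 0 ≤ K)
    (hg : ContinuousOn g (Icc a b))
    (h : ∀ t ∈ Icc a b, g t ≤ c + K * ∫ s in a..t, g s) : g b ≤ c * Real.exp (K * (b - a)) := by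
  let p := IccExtend hab (fun t : Icc a b => g t)
  have hp : Continuous p := hg.domRestrict.Icc_extend'
  have pg : ∀ t ∈ Icc a b, p t = g t := fun t ht => IccExtend_of_mem hab _ ht
  have hpi : ∀ t ∈ Icc a b, ∫ s in a..t, p s = ∫ s in a..t, g s := by
    intro t ht
    refine intervalIntegral.integral_congr fun s hs => pg s ?_
    rw [uIcc_of_le ht.1] at hs
    exact ⟨hs.1, hs.2.trans ht.2⟩
  have hd : ∀ x, HasDerivAt (fun t => c + K * ∫ s in a..t, p s) (K * p x) x := fun x =>
    ((hp.integral_hasStrictDerivAt a x).hasDerivAt.const_mul K).const_add c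
  -- The differential form of the inequality is applied to the upper bound `c + K ∫ p`, which is
  -- differentiable although `g` is only continuous.
  have key := le_gronwallBound_of_liminf_deriv_right_le (δ := c) (K := K) (ε := 0)
    (f := fun t => c + K * ∫ s in a..t, p s) (f' := fun x => K * p x) (a := a) (b := b)
    (fun x _ => (hd x).continuousAt.continuousWithinAt)
    (fun x _ r hr => (hd x).hasDerivWithinAt.liminf_right_slope_le hr) (by simp)
    (fun x hx => by
      have hx' := Ico_subset_Icc_self hx
      rw [pg x hx', hpi x hx', add_zero]
      gcongr
      exact h x hx') b (right_mem_Icc.2 hab)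
  rw [gronwallBound_ε0, hpi b (right_mem_Icc.2 hab)] at key
  exact (h b (right_mem_Icc.2 hab)).trans key

/-! ### The action of matrices on Euclidean vectors -/

section EuclideanAction

variable {l m n : Type*} [Fintype m] [Fintype n] [DecidableEq n]

theorem norm_toEuclideanLin_le (M : Matrix m n ℝ) (v : EuclideanSpace ℝ n) :
    ‖toEuclideanLin M v‖ ≤ ‖M‖ * ‖v‖ :=
  l2_opNorm_mulVec M v

theorem norm_le_of_toEuclideanLin_le {M : Matrix m n ℝ} {c : ℝ} (hc : 0 ≤ c)
    (h : ∀ v, ‖toEuclideanLin M v‖ ≤ c * ‖v‖) : ‖M‖ ≤ c :=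
  ContinuousLinearMap.opNorm_le_bound _ hc h

theorem toEuclideanLin_mul [DecidableEq m] (A : Matrix l m ℝ) (B : Matrix m n ℝ) (v : EuclideanSpace ℝ n) :
    toEuclideanLin (A * B) v = toEuclideanLin A (toEuclideanLin B v) :=
  congr($(Matrix.toLpLin_mul_same 2 A B) v)

theorem toEuclideanLin_one_apply (v : EuclideanSpace ℝ n) :
    toEuclideanLin (1 : Matrix n n ℝ) v = v :=
  congr($(Matrix.toLpLin_one 2) v)

theorem aestronglyMeasurable_toEuclideanLin {μ : Measure ℝ} {X : ℝ → Matrix m n ℝ}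
    {x : ℝ → EuclideanSpace ℝ n} (hX : AEStronglyMeasurable X μ) (hx : AEStronglyMeasurable x μ) :
    AEStronglyMeasurable (fun t => toEuclideanLin (X t) (x t)) μ := by
  let L : Matrix m n ℝ →L[ℝ] EuclideanSpace ℝ n →L[ℝ] EuclideanSpace ℝ m :=
    LinearMap.toContinuousLinearMap
      ((toEuclideanLin (𝕜 := ℝ) (m := m) (n := n)).trans
        LinearMap.toContinuousLinearMap).toLinearMap
  exact L.aestronglyMeasurable_comp₂ hX hx

theorem IsPrimitive.toEuclideanLin {X f : ℝ → Matrix m n ℝ} {x g : ℝ → EuclideanSpace ℝ n}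
    (hX : IsPrimitive X f) (hx : IsPrimitive x g) :
    IsPrimitive (fun t => toEuclideanLin (X t) (x t))
      (fun t => Matrix.toEuclideanLin (f t) (x t) + Matrix.toEuclideanLin (X t) (g t)) :=
  IsPrimitive.bilin (Matrix.toEuclideanLin (𝕜 := ℝ) (m := m) (n := n)).toLinearMap hX hx

theorem IsPrimitive.matrix_mul [Fintype l] [DecidableEq m] {X f : ℝ → Matrix l m ℝ} {Y g : ℝ → Matrix m n ℝ}
    (hX : IsPrimitive X f) (hY : IsPrimitive Y g) :
    IsPrimitive (fun t => X t * Y t) (fun t => f t * Y t + X t * g t) :=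
  IsPrimitive.bilin (LinearMap.mk₂ ℝ (fun (A : Matrix l m ℝ) (B : Matrix m n ℝ) => A * B)
    Matrix.add_mul (fun c A B => Matrix.smul_mul c A B) Matrix.mul_add
    (fun c A B => Matrix.mul_smul A c B)) hX hY

end EuclideanAction

/-! ### Bounded Lipschitz and bounded measurable functions on `J` -/

section Classes

variable {E : Type*} [NormedAddCommGroup E]

/-- Bounded and Lipschitz on `J`. -/
def BddLip (X : ℝ → E) : Prop :=
  ∃ K : ℝ, (∀ t, 0 ≤ t → ‖X t‖ ≤ K) ∧ ∀ s t, 0 ≤ s → 0 ≤ t → ‖X s - X t‖ ≤ K * |s - t|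

/-- Bounded and almost everywhere strongly measurable on `J`. -/
def BddMeas (X : ℝ → E) : Prop :=
  UniformlyBounded X ∧ AEStronglyMeasurable X (volume.restrict (Ici 0))

theorem BddLip.lipschitzOnWith {X : ℝ → E} (h : BddLip X) : ∃ K, LipschitzOnWith K X (Ici 0) := by
  obtain ⟨K, _, h2⟩ := h
  refine ⟨K.toNNReal, LipschitzOnWith.of_dist_le_mul fun s hs t ht => ?_⟩
  rw [dist_eq_norm, Real.dist_eq]
  refine (h2 s t hs ht).trans ?_
  gcongr
  exact Real.le_coe_toNNReal K

theorem BddLip.continuousOn {X : ℝ → E} (h : BddLip X) : ContinuousOn X (Ici 0) :=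
  h.lipschitzOnWith.choose_spec.continuousOn

theorem BddLip.uniformlyBounded {X : ℝ → E} (h : BddLip X) : UniformlyBounded X :=
  ⟨h.choose, h.choose_spec.1⟩

theorem BddLip.bddMeas {X : ℝ → E} (h : BddLip X) : BddMeas X :=
  ⟨h.uniformlyBounded, h.continuousOn.aestronglyMeasurable measurableSet_Ici⟩

theorem BddLip.const (c : E) : BddLip fun _ : ℝ => c :=
  ⟨‖c‖, fun _ _ => le_rfl, fun s t _ _ => by simpa using by positivity⟩

theorem BddLip.add {X Y : ℝ → E} (hX : BddLip X) (hY : BddLip Y) :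
    BddLip fun t => X t + Y t := by
  obtain ⟨K, h1, h2⟩ := hX
  obtain ⟨L, h3, h4⟩ := hY
  refine ⟨K + L, fun t ht => (norm_add_le _ _).trans (add_le_add (h1 t ht) (h3 t ht)),
    fun s t hs ht => ?_⟩
  rw [add_sub_add_comm, add_mul]
  exact (norm_add_le _ _).trans (add_le_add (h2 s t hs ht) (h4 s t hs ht))

theorem BddLip.neg {X : ℝ → E} (hX : BddLip X) : BddLip fun t => -X t := by
  obtain ⟨K, h1, h2⟩ := hX
  refine ⟨K, fun t ht => (norm_neg (X t)).trans_le (h1 t ht), fun s t hs ht => ?_⟩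
  rw [neg_sub_neg, norm_sub_rev]
  exact h2 s t hs ht

theorem BddLip.sub {X Y : ℝ → E} (hX : BddLip X) (hY : BddLip Y) :
    BddLip fun t => X t - Y t := by
  simpa only [sub_eq_add_neg] using hX.add hY.neg

theorem BddLip.congr {X Y : ℝ → E} (hX : BddLip X) (h : ∀ t, 0 ≤ t → X t = Y t) : BddLip Y := by
  obtain ⟨K, h1, h2⟩ := hX
  exact ⟨K, fun t ht => h t ht ▸ h1 t ht, fun s t hs ht => h t ht ▸ h s hs ▸ h2 s t hs ht⟩

theorem BddLip.of_lipschitzOnWith {X : ℝ → E} (h : UniformlyBounded X)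
    (hL : ∃ K, LipschitzOnWith K X (Ici 0)) : BddLip X := by
  obtain ⟨K, h1⟩ := h
  obtain ⟨L, h2⟩ := hL
  refine ⟨max K L, fun t ht => (h1 t ht).trans (le_max_left _ _), fun s t hs ht => ?_⟩
  have := h2.dist_le_mul s hs t ht
  rw [dist_eq_norm, Real.dist_eq] at this
  refine this.trans ?_
  gcongr
  exact le_max_right _ _

theorem BddLip.of_derivWithin [NormedSpace ℝ E] {X : ℝ → E} (h : UniformlyBounded X)
    (hd : DifferentiableOn ℝ X (Ici 0))
    (hb : UniformlyBounded fun t => derivWithin X (Ici 0) t) : BddLip X := by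
  obtain ⟨K, hK⟩ := hb
  refine BddLip.of_lipschitzOnWith h ⟨K.toNNReal,
    (convex_Ici 0).lipschitzOnWith_of_nnnorm_derivWithin_le hd fun t ht => ?_⟩
  exact NNReal.coe_le_coe.1 ((hK t ht).trans (Real.le_coe_toNNReal K))

theorem BddMeas.exists_bound {X : ℝ → E} (h : BddMeas X) :
    ∃ K : ℝ, 0 < K ∧ ∀ t, 0 ≤ t → ‖X t‖ ≤ K := by
  obtain ⟨K, hK⟩ := h.1
  exact ⟨max K 1, by positivity, fun t ht => (hK t ht).trans (le_max_left _ _)⟩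

theorem BddMeas.add {X Y : ℝ → E} (hX : BddMeas X) (hY : BddMeas Y) :
    BddMeas fun t => X t + Y t := by
  obtain ⟨⟨K, h1⟩, h2⟩ := hX
  obtain ⟨⟨L, h3⟩, h4⟩ := hY
  exact ⟨⟨K + L, fun t ht => (norm_add_le _ _).trans (add_le_add (h1 t ht) (h3 t ht))⟩,
    h2.add h4⟩

theorem BddMeas.neg {X : ℝ → E} (hX : BddMeas X) : BddMeas fun t => -X t := by
  obtain ⟨⟨K, h1⟩, h2⟩ := hX
  exact ⟨⟨K, fun t ht => (norm_neg (X t)).trans_le (h1 t ht)⟩, h2.neg⟩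

theorem BddMeas.sub {X Y : ℝ → E} (hX : BddMeas X) (hY : BddMeas Y) :
    BddMeas fun t => X t - Y t := by
  simpa only [sub_eq_add_neg] using hX.add hY.neg

theorem BddMeas.intervalIntegrable {X : ℝ → E} (hX : BddMeas X) {a b : ℝ} (ha : 0 ≤ a)
    (hb : 0 ≤ b) : IntervalIntegrable X volume a b := by
  obtain ⟨⟨K, h1⟩, h2⟩ := hX
  have hs : uIoc a b ⊆ Ici 0 := fun t ht => (le_min ha hb).trans ht.1.le
  refine (intervalIntegrable_const (c := K)).mono_fun (h2.mono_set hs) ?_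
  filter_upwards [ae_restrict_mem measurableSet_uIoc] with t ht
  exact (h1 t (hs ht)).trans (le_abs_self _)

end Classes

section MatrixClasses

variable {l m n : Type*} [Fintype m] [Fintype n] [DecidableEq n]

theorem BddLip.matrix_mul [Fintype l] [DecidableEq m] {X : ℝ → Matrix l m ℝ} {Y : ℝ → Matrix m n ℝ} (hX : BddLip X)
    (hY : BddLip Y) : BddLip fun t => X t * Y t := by
  obtain ⟨K, h1, h2⟩ := hX
  obtain ⟨L, h3, h4⟩ := hY
  have hK : 0 ≤ K := (norm_nonneg _).trans (h1 0 le_rfl)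
  have hL : 0 ≤ L := (norm_nonneg _).trans (h3 0 le_rfl)
  have e : 0 ≤ K * L := by positivity
  refine ⟨2 * (K * L), fun t ht => (l2_opNorm_mul _ _).trans ?_, fun s t hs ht => ?_⟩
  · have : ‖X t‖ * ‖Y t‖ ≤ K * L := by
      gcongr
      exacts [h1 t ht, h3 t ht]
    linarith
  · have e : X s * Y s - X t * Y t = (X s - X t) * Y s + X t * (Y s - Y t) := by
      rw [Matrix.sub_mul, Matrix.mul_sub]; abel
    rw [e]
    calc _ ≤ ‖X s - X t‖ * ‖Y s‖ + ‖X t‖ * ‖Y s - Y t‖ :=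
          (norm_add_le _ _).trans (add_le_add (l2_opNorm_mul _ _) (l2_opNorm_mul _ _))
      _ ≤ (K * |s - t|) * L + K * (L * |s - t|) := by
          gcongr
          exacts [h2 s t hs ht, h3 s hs, h1 t ht, h4 s t hs ht]
      _ = _ := by ring

theorem l2_opNorm_transpose [DecidableEq m] (M : Matrix m n ℝ) : ‖Mᵀ‖ = ‖M‖ := by
  rw [← conjTranspose_eq_transpose_of_trivial, l2_opNorm_conjTranspose]

theorem BddLip.transpose [DecidableEq m] {X : ℝ → Matrix m n ℝ} (hX : BddLip X) : BddLip fun t => (X t)ᵀ := by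
  obtain ⟨K, h1, h2⟩ := hX
  refine ⟨K, fun t ht => (l2_opNorm_transpose (X t)).trans_le (h1 t ht), fun s t hs ht => ?_⟩
  rw [← transpose_sub, l2_opNorm_transpose]
  exact h2 s t hs ht

/-- By the resolvent identity `X(s)⁻¹ - X(t)⁻¹ = X(s)⁻¹ (X(t) - X(s)) X(t)⁻¹`, a bound on the
inverses yields a Lipschitz constant. -/
theorem BddLip.inv {X : ℝ → Matrix n n ℝ} (hX : BddLip X) (hu : ∀ t, 0 ≤ t → IsUnit (X t).det)
    (hb : UniformlyBounded fun t => (X t)⁻¹) : BddLip fun t => (X t)⁻¹ := by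
  obtain ⟨K, h1, h2⟩ := hX
  obtain ⟨c, hc⟩ := hb
  have hc0 : 0 ≤ c := (norm_nonneg _).trans (hc 0 le_rfl)
  refine BddLip.of_lipschitzOnWith ⟨c, hc⟩ ⟨(c * K * c).toNNReal,
    LipschitzOnWith.of_dist_le_mul fun s hs t ht => ?_⟩
  rw [dist_eq_norm, Real.dist_eq]
  have e : (X s)⁻¹ - (X t)⁻¹ = (X s)⁻¹ * (X t - X s) * (X t)⁻¹ := by
    rw [Matrix.mul_sub, Matrix.sub_mul, Matrix.nonsing_inv_mul _ (hu s hs), Matrix.mul_assoc,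
      Matrix.mul_nonsing_inv _ (hu t ht), Matrix.mul_one, Matrix.one_mul]
  rw [e]
  calc _ ≤ ‖(X s)⁻¹‖ * ‖X t - X s‖ * ‖(X t)⁻¹‖ :=
        (l2_opNorm_mul _ _).trans (by gcongr; exact l2_opNorm_mul _ _)
    _ ≤ c * (K * |s - t|) * c := by
        have h3 : 0 ≤ K * |s - t| := (norm_nonneg _).trans (h2 s t hs ht)
        gcongr
        · exact hc s hs
        · rw [norm_sub_rev]; exact h2 s t hs ht
        · exact hc t ht
    _ = (c * K * c) * |s - t| := by ring
    _ ≤ _ := by gcongr; exact Real.le_coe_toNNReal _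

theorem BddMeas.matrix_mul [Fintype l] [DecidableEq m] {X : ℝ → Matrix l m ℝ} {Y : ℝ → Matrix m n ℝ} (hX : BddMeas X)
    (hY : BddMeas Y) : BddMeas fun t => X t * Y t := by
  obtain ⟨⟨K, h1⟩, h2⟩ := hX
  obtain ⟨⟨L, h3⟩, h4⟩ := hY
  have hK : 0 ≤ K := (norm_nonneg _).trans (h1 0 le_rfl)
  refine ⟨⟨K * L, fun t ht => (l2_opNorm_mul _ _).trans ?_⟩, ?_⟩
  · gcongr
    exacts [h1 t ht, h3 t ht]
  · exact (Continuous.matrix_mul continuous_fst continuous_snd).comp_aestronglyMeasurable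
      (h2.prodMk h4)

theorem MeasurableMatrix.stronglyMeasurable {X : ℝ → Matrix m n ℝ} (h : MeasurableMatrix X) :
    StronglyMeasurable X := by
  classical
  have e : X = fun t => ∑ i, ∑ j, X t i j • Matrix.single i j (1 : ℝ) := by
    funext t
    conv_lhs => rw [Matrix.matrix_eq_sum_single (X t)]
    simp
  rw [e]
  refine Finset.stronglyMeasurable_fun_sum _ fun i _ => Finset.stronglyMeasurable_fun_sum _
    fun j _ => ?_
  exact (h i j).stronglyMeasurable.smul_const _

theorem BddMeas.of_measurableMatrix {X : ℝ → Matrix m n ℝ} (h : MeasurableMatrix X)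
    (hb : UniformlyBounded X) : BddMeas X :=
  ⟨hb, h.stronglyMeasurable.aestronglyMeasurable⟩

/-- Observer and detector gains must be measurable and bounded at every time. A measurable
representative may exceed the bound on a null set, so it is cut off to zero there. -/
theorem BddMeas.exists_measurableMatrix {X : ℝ → Matrix m n ℝ} (h : BddMeas X) :
    ∃ Y : ℝ → Matrix m n ℝ, MeasurableMatrix Y ∧ UniformlyBounded Y ∧
      ∀ᵐ t, 0 ≤ t → X t = Y t := by
  classical
  obtain ⟨⟨K, h1⟩, h2⟩ := h
  have hK : 0 ≤ K := (norm_nonneg _).trans (h1 0 le_rfl)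
  have hs : MeasurableSet {t | ‖h2.mk X t‖ ≤ K} :=
    h2.stronglyMeasurable_mk.norm.measurable measurableSet_Iic
  have hm : StronglyMeasurable ({t | ‖h2.mk X t‖ ≤ K}.indicator (h2.mk X)) :=
    h2.stronglyMeasurable_mk.indicator hs
  refine ⟨{t | ‖h2.mk X t‖ ≤ K}.indicator (h2.mk X), fun i j => ?_, ⟨K, fun t _ => ?_⟩, ?_⟩
  · exact ((continuous_id.matrix_elem i j).comp_stronglyMeasurable hm).measurable
  · by_cases ht : ‖h2.mk X t‖ ≤ K
    · rwa [indicator_of_mem (by exact ht)]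
    · rw [indicator_of_notMem (by exact ht), norm_zero]; exact hK
  · filter_upwards [(ae_restrict_iff' measurableSet_Ici).1 h2.ae_eq_mk] with t ht ht0
    have := ht ht0
    rw [indicator_of_mem]
    · exact this
    · change ‖_‖ ≤ K
      rw [← this]; exact h1 t ht0

theorem BddMeas.aestronglyMeasurable_mulVec {X : ℝ → Matrix m n ℝ} (hX : BddMeas X) {x : ℝ → EuclideanSpace ℝ n}
    (hx : ContinuousOn x (Ici 0)) :
    AEStronglyMeasurable (fun t => Matrix.toEuclideanLin (X t) (x t)) (volume.restrict (Ici 0)) :=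
  aestronglyMeasurable_toEuclideanLin hX.2 (hx.aestronglyMeasurable measurableSet_Ici)

theorem BddMeas.mulVec_const {X : ℝ → Matrix m n ℝ} (hX : BddMeas X)
    (v : EuclideanSpace ℝ n) : BddMeas fun t => Matrix.toEuclideanLin (X t) v := by
  refine ⟨?_, hX.aestronglyMeasurable_mulVec continuousOn_const⟩
  obtain ⟨K, hK⟩ := hX.1
  exact ⟨K * ‖v‖, fun t ht => (norm_toEuclideanLin_le _ _).trans (by gcongr; exact hK t ht)⟩

/-- A bounded Lipschitz function on `J` is an indefinite integral of a bounded measurable one. -/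
theorem BddLip.exists_isPrimitive {E : Type*} [NormedAddCommGroup E] [NormedSpace ℝ E]
    [FiniteDimensional ℝ E] {X : ℝ → E} (hX : BddLip X) : ∃ f, BddMeas f ∧ IsPrimitive X f := by
  obtain ⟨K, hK⟩ := hX.lipschitzOnWith
  obtain ⟨f, h1, h2, h3⟩ := IsPrimitive.exists_of_lipschitz hK
  exact ⟨f, ⟨⟨K, fun t _ => h2 t⟩, h1.aestronglyMeasurable⟩, h3⟩

end MatrixClasses

/-! ### The pseudoinverse of a uniformly injective matrix function -/

section Pseudoinverse

variable {p q : ℕ}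

theorem isUnit_det_of_posSemidef_sub {X : Matrix (Fin q) (Fin q) ℝ} {γ : ℝ} (hγ : 0 < γ)
    (h : (X - γ • (1 : Matrix (Fin q) (Fin q) ℝ)).PosSemidef) : IsUnit X.det := by
  have h1 : X.PosDef := by
    have := (PosDef.one (n := Fin q) (R := ℝ)).smul hγ
    simpa using this.add_posSemidef h
  exact (Matrix.isUnit_iff_isUnit_det _).1 h1.isUnit

/-- Cauchy-Schwarz turns `⟨X v, v⟩ ≥ γ ‖v‖²` into `‖X v‖ ≥ γ ‖v‖`, which is then read at `X⁻¹ v`. -/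
theorem norm_inv_le_of_posSemidef_sub {X : Matrix (Fin q) (Fin q) ℝ} {γ : ℝ} (hγ : 0 < γ)
    (h : (X - γ • (1 : Matrix (Fin q) (Fin q) ℝ)).PosSemidef) : ‖X⁻¹‖ ≤ γ⁻¹ := by
  have hu := isUnit_det_of_posSemidef_sub hγ h
  have low : ∀ v, γ * ‖v‖ ≤ ‖toEuclideanLin X v‖ := by
    intro v
    have h1 := (Matrix.isPositive_toEuclideanLin_iff.2 h).re_inner_nonneg_left v
    rw [map_sub, LinearMap.sub_apply, inner_sub_left, map_smul, LinearMap.smul_apply,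
      toEuclideanLin_one_apply, inner_smul_left, real_inner_self_eq_norm_sq] at h1
    simp only [RCLike.re_to_real, conj_trivial] at h1
    have h2 := real_inner_le_norm (toEuclideanLin X v) v
    rcases (norm_nonneg v).eq_or_lt with h0 | h0
    · rw [← h0, mul_zero]; exact norm_nonneg _
    · have : γ * ‖v‖ * ‖v‖ ≤ ‖toEuclideanLin X v‖ * ‖v‖ := by nlinarith
      exact le_of_mul_le_mul_right this h0
  refine norm_le_of_toEuclideanLin_le (by positivity) fun v => ?_
  have h1 := low (toEuclideanLin X⁻¹ v)
  rw [← toEuclideanLin_mul, Matrix.mul_nonsing_inv _ hu, toEuclideanLin_one_apply] at h1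
  rwa [← div_eq_inv_mul, le_div_iff₀' hγ]

theorem pinv_eq_of_isUnit {M : Matrix (Fin p) (Fin q) ℝ} (hu : IsUnit (Mᵀ * M).det) :
    pinv M = (Mᵀ * M)⁻¹ * Mᵀ := by
  refine (pinv_spec M).unique ⟨?_, ?_, ?_, ?_⟩
  · rw [Matrix.mul_assoc, Matrix.mul_assoc, Matrix.nonsing_inv_mul _ hu, Matrix.mul_one]
  · rw [Matrix.mul_assoc _ Mᵀ M, Matrix.nonsing_inv_mul _ hu, Matrix.one_mul]
  · rw [transpose_mul, transpose_mul, transpose_transpose, transpose_nonsing_inv, transpose_mul,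
      transpose_transpose, Matrix.mul_assoc]
  · rw [Matrix.mul_assoc, Matrix.nonsing_inv_mul _ hu, transpose_one]

theorem pinv_mul_self_of_isUnit {M : Matrix (Fin p) (Fin q) ℝ} (hu : IsUnit (Mᵀ * M).det) :
    pinv M * M = 1 := by
  rw [pinv_eq_of_isUnit hu, Matrix.mul_assoc, Matrix.nonsing_inv_mul _ hu]

theorem BddLip.pinv {Γ : ℝ → Matrix (Fin p) (Fin q) ℝ} (hΓ : BddLip Γ) {γ : ℝ} (hγ : 0 < γ)
    (h : ∀ t, 0 ≤ t → ((Γ t)ᵀ * Γ t - γ • (1 : Matrix (Fin q) (Fin q) ℝ)).PosSemidef) :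
    BddLip fun t => pinv (Γ t) := by
  have hu := fun t ht => isUnit_det_of_posSemidef_sub hγ (h t ht)
  refine (((hΓ.transpose.matrix_mul hΓ).inv hu ⟨γ⁻¹, fun t ht =>
    norm_inv_le_of_posSemidef_sub hγ (h t ht)⟩).matrix_mul hΓ.transpose).congr fun t ht => ?_
  rw [pinv_eq_of_isUnit (hu t ht)]

end Pseudoinverse

/-! ### Linear equations with bounded measurable coefficients -/

section LinearEquation

variable {n : ℕ}

theorem exists_linear_solution {B : ℝ → Matrix (Fin n) (Fin n) ℝ} (hB : BddMeas B) (s : ℝ)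
    (v : EuclideanSpace ℝ (Fin n)) :
    ∃ x, x s = v ∧ IsSolution (fun t v => toEuclideanLin (B t) v) x := by
  obtain ⟨K, hK, hb⟩ := hB.exists_bound
  refine exists_isSolution (K := K) _ (fun x hx => hB.aestronglyMeasurable_mulVec hx)
    (fun t ht u v => ?_) (fun t _ => ?_) s v
  · rw [← map_sub]
    exact (norm_toEuclideanLin_le _ _).trans (by gcongr; exact hb t ht)
  · rw [map_zero, norm_zero]; exact hK.le

theorem norm_solution_le {B : ℝ → Matrix (Fin n) (Fin n) ℝ} {K : ℝ}
    (hB : ∀ t, 0 ≤ t → ‖B t‖ ≤ K) {x : ℝ → EuclideanSpace ℝ (Fin n)}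
    (hx : IsSolution (fun t v => toEuclideanLin (B t) v) x) {s t : ℝ} (hs : 0 ≤ s) (hst : s ≤ t) :
    ‖x t‖ ≤ ‖x s‖ * Real.exp (K * (t - s)) := by
  have hp : IsPrimitive x (fun t => toEuclideanLin (B t) (x t)) := hx
  have hK : 0 ≤ K := (norm_nonneg _).trans (hB 0 le_rfl)
  have hc : ContinuousOn (fun t => ‖x t‖) (Icc s t) :=
    (hp.continuousOn.mono fun u hu => hs.trans hu.1).norm
  refine le_mul_exp_of_le_integral (g := fun t => ‖x t‖) hst hK hc fun u hu => ?_
  have hi : IntervalIntegrable (fun r => K * ‖x r‖) volume s u :=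
    ((hc.mono (by rw [uIcc_of_le hu.1]; exact Icc_subset_Icc_right hu.2)).intervalIntegrable).const_mul
      K
  have h1 := intervalIntegral.norm_integral_le_of_norm_le hu.1
    (f := fun t => toEuclideanLin (B t) (x t)) (Eventually.of_forall fun r hr =>
      (norm_toEuclideanLin_le (B r) (x r)).trans
        (mul_le_mul_of_nonneg_right (hB r (hs.trans hr.1.le)) (norm_nonneg _))) hi
  rw [intervalIntegral.integral_const_mul, ← hp.sub_eq hs (hs.trans hu.1)] at h1
  calc ‖x u‖ = ‖x s + (x u - x s)‖ := by congr 1; abel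
    _ ≤ _ := (norm_add_le _ _).trans (by gcongr)

theorem IsSolution.congr_ae {B B' : ℝ → Matrix (Fin n) (Fin n) ℝ}
    (h : ∀ᵐ t, 0 ≤ t → B t = B' t) {x : ℝ → EuclideanSpace ℝ (Fin n)}
    (hx : IsSolution (fun t v => toEuclideanLin (B t) v) x) :
    IsSolution (fun t v => toEuclideanLin (B' t) v) x := by
  refine IsPrimitive.congr hx (fun _ _ => rfl) ?_
  filter_upwards [h] with t ht h0
  simp only [ht h0]

theorem UES.congr_ae {B B' : ℝ → Matrix (Fin n) (Fin n) ℝ} (hU : UES B)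
    (h : ∀ᵐ t, 0 ≤ t → B t = B' t) : UES B' := by
  obtain ⟨M, μ, hM, hμ, H⟩ := hU
  refine ⟨M, μ, hM, hμ, fun x hx => H x (hx.congr_ae ?_)⟩
  filter_upwards [h] with t ht h0 using (ht h0).symm

/-- Solutions which halve over windows of fixed length decay exponentially. -/
theorem UES.of_halving {B : ℝ → Matrix (Fin n) (Fin n) ℝ} (hB : UniformlyBounded B) {T : ℝ}
    (hT : 0 < T) (h : ∀ x : ℝ → EuclideanSpace ℝ (Fin n),
      IsSolution (fun t v => toEuclideanLin (B t) v) x →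
      ∀ s, 0 ≤ s → ‖x (s + T)‖ ≤ 1 / 2 * ‖x s‖) : UES B := by
  obtain ⟨K, hK⟩ := hB
  have hK0 : 0 ≤ K := (norm_nonneg _).trans (hK 0 le_rfl)
  have hl2 : 0 < Real.log 2 := Real.log_pos (by norm_num)
  refine ⟨2 * Real.exp (K * T), Real.log 2 / T, by positivity, by positivity,
    fun x hx s t hs hst => ?_⟩
  have iter : ∀ k : ℕ, ‖x (s + k * T)‖ ≤ (1 / 2) ^ k * ‖x s‖ := by
    intro k
    induction k with
    | zero => simp
    | succ k ih =>
      have h1 := h x hx (s + k * T) (by positivity)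
      have e : s + ((k + 1 : ℕ) : ℝ) * T = s + k * T + T := by push_cast; ring
      rw [e]
      calc _ ≤ 1 / 2 * ((1 / 2) ^ k * ‖x s‖) := h1.trans (by gcongr)
        _ = _ := by ring
  -- The number of complete windows in `[s, t]`. The incomplete one costs `exp (K T)` by Grönwall,
  -- and rounding down costs the factor `2`.
  set k := ⌊(t - s) / T⌋₊ with hk
  have hq : 0 ≤ (t - s) / T := div_nonneg (by linarith) hT.le
  have hk1 : (k : ℝ) * T ≤ t - s := by
    rw [← le_div_iff₀ hT]; exact Nat.floor_le hq
  have hk2 : (t - s) / T ≤ k + 1 := (Nat.lt_floor_add_one _).le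
  have hk3 : t - s ≤ k * T + T := by
    rw [div_le_iff₀ hT] at hk2; linarith
  have h1 := norm_solution_le hK hx (s := s + k * T) (t := t) (by positivity) (by linarith)
  have h2 : Real.exp (K * (t - (s + k * T))) ≤ Real.exp (K * T) := by
    gcongr; linarith
  have h3 : ((1 : ℝ) / 2) ^ k ≤ 2 * Real.exp (-(Real.log 2 / T) * (t - s)) := by
    have e1 : ((1 : ℝ) / 2) ^ k = Real.exp (-(k * Real.log 2)) := by
      rw [Real.exp_neg, ← Real.log_pow, Real.exp_log (by positivity), one_div, inv_pow]
    have e2 : (2 : ℝ) = Real.exp (Real.log 2) := (Real.exp_log (by norm_num)).symm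
    rw [e1]
    conv_rhs => rw [e2]
    rw [Real.log_exp, ← Real.exp_add]
    gcongr
    have : Real.log 2 / T * (t - s) = (t - s) / T * Real.log 2 := by ring
    nlinarith
  calc ‖x t‖ ≤ ((1 / 2) ^ k * ‖x s‖) * Real.exp (K * T) :=
        h1.trans (mul_le_mul (iter k) h2 (Real.exp_pos _).le (by positivity))
    _ ≤ ((2 * Real.exp (-(Real.log 2 / T) * (t - s))) * ‖x s‖) * Real.exp (K * T) := by gcongr
    _ = _ := by ring

/-- Uniform exponential stability persists under bounded perturbations `Ẇ C` with `C` bounded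
Lipschitz and `W` uniformly small, however large `Ẇ` is. -/
theorem UES.exists_averaging {m : ℕ} {B : ℝ → Matrix (Fin n) (Fin n) ℝ} (hB : BddMeas B)
    (hU : UES B) {C : ℝ → Matrix (Fin m) (Fin n) ℝ} (hC : BddLip C) (K' : ℝ) :
    ∃ ε : ℝ, 0 < ε ∧ ∀ (B' : ℝ → Matrix (Fin n) (Fin n) ℝ) (W ω : ℝ → Matrix (Fin n) (Fin m) ℝ),
      (∀ t, 0 ≤ t → ‖B' t‖ ≤ K') → IsPrimitive W ω → (∀ t, 0 ≤ t → ‖W t‖ ≤ ε) →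
      (∀ t, 0 ≤ t → B' t = B t + ω t * C t) → UES B' := by
  obtain ⟨M, μ, hM, hμ, H⟩ := hU
  obtain ⟨K, hK, hKb⟩ := hB.exists_bound
  obtain ⟨k, hk, hkb⟩ := hC.bddMeas.exists_bound
  obtain ⟨c, hcm, hcp⟩ := hC.exists_isPrimitive
  obtain ⟨k', hk', hkb'⟩ := hcm.exists_bound
  obtain ⟨T, hT, hTM⟩ : ∃ T : ℝ, 0 < T ∧ M * Real.exp (-μ * T) ≤ 1 / 4 := by
    have h1 : Tendsto (fun T : ℝ => M * Real.exp (-μ * T)) atTop (𝓝 (M * 0)) := by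
      refine (Real.tendsto_exp_atBot.comp ?_).const_mul M
      exact tendsto_id.const_mul_atTop_of_neg (by linarith)
    rw [mul_zero] at h1
    obtain ⟨T, h2, h3⟩ := ((h1.eventually_le_const (by norm_num : (0 : ℝ) < 1 / 4)).and
      (eventually_gt_atTop 0)).exists
    exact ⟨T, h3, h2⟩
  set L := max K' 0 with hL
  have hL0 : 0 ≤ L := le_max_right _ _
  -- `ε Q ‖x s‖` will bound the deviation `x - z` at the end of a window: `2 k` comes from the
  -- boundary values of `W C x`, `k' + k L` from the derivative of `C x`, the exponentials from the
  -- growth of `x` and from Grönwall. Nothing here depends on `B'` beyond the bound `K'`.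
  set Q := (2 * k + (k' + k * L) * T) * Real.exp (L * T) * Real.exp (K * T) with hQ
  have hQ0 : 0 ≤ Q := by positivity
  refine ⟨1 / (4 * (Q + 1)), by positivity, fun B' W ω hB' hW hWε hBB => ?_⟩
  set ε := 1 / (4 * (Q + 1)) with hε
  have hε0 : 0 < ε := by positivity
  have hεQ : ε * Q ≤ 1 / 4 := by
    rw [hε, div_mul_eq_mul_div, div_le_div_iff₀ (by positivity) (by norm_num)]
    linarith
  refine UES.of_halving ⟨K', hB'⟩ hT fun x hx s hs => ?_
  have hB'L : ∀ t, 0 ≤ t → ‖B' t‖ ≤ L := fun t ht => (hB' t ht).trans (le_max_left _ _)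
  obtain ⟨z, hzs, hz⟩ := exists_linear_solution hB s (x s)
  have hxp : IsPrimitive x (fun t => toEuclideanLin (B' t) (x t)) := hx
  have hzp : IsPrimitive z (fun t => toEuclideanLin (B t) (z t)) := hz
  have hy := hcp.toEuclideanLin hxp
  have hWy := hW.toEuclideanLin hy
  -- Subtracting `W C x` integrates the large term `ω C x` by parts: the derivative of `x - z - W C
  -- x` is `B (x - z) - W (Ċ x + C B' x)`, where only the small `W` remains.
  have hd := (hxp.sub hzp).sub hWy
  set m₀ := ‖x s‖ * Real.exp (L * T) with hm₀
  have hm0 : 0 ≤ m₀ := by positivity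
  have hxm : ∀ t, s ≤ t → t ≤ s + T → ‖x t‖ ≤ m₀ := by
    intro t h1 h2
    refine (norm_solution_le hB'L hx hs h1).trans ?_
    rw [hm₀]
    gcongr
    linarith
  have hym : ∀ t, s ≤ t → t ≤ s + T → ‖toEuclideanLin (C t) (x t)‖ ≤ k * m₀ := fun t h1 h2 =>
    (norm_toEuclideanLin_le _ _).trans
      (mul_le_mul (hkb t (hs.trans h1)) (hxm t h1 h2) (norm_nonneg _) hk.le)
  have hWym : ∀ t, s ≤ t → t ≤ s + T →
      ‖toEuclideanLin (W t) (toEuclideanLin (C t) (x t))‖ ≤ ε * (k * m₀) := fun t h1 h2 =>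
    (norm_toEuclideanLin_le _ _).trans
      (mul_le_mul (hWε t (hs.trans h1)) (hym t h1 h2) (norm_nonneg _) hε0.le)
  have hcont : ContinuousOn (fun t => ‖x t - z t‖) (Icc s (s + T)) :=
    ((hxp.sub hzp).continuousOn.mono fun u hu => hs.trans hu.1).norm
  have hdiff : ‖x (s + T) - z (s + T)‖ ≤
      ε * ((2 * k + (k' + k * L) * T) * m₀) * Real.exp (K * (s + T - s)) := by
    refine le_mul_exp_of_le_integral (g := fun t => ‖x t - z t‖) (by linarith) hK.le hcont
      fun u hu => ?_
    have hu0 : 0 ≤ u := hs.trans hu.1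
    have e := hd.sub_eq hs hu0
    have hi : IntervalIntegrable (fun r => K * ‖x r - z r‖ + ε * ((k' + k * L) * m₀))
        volume s u :=
      (((hcont.mono (by
        rw [uIcc_of_le hu.1]; exact Icc_subset_Icc_right hu.2)).intervalIntegrable).const_mul
          K).add intervalIntegrable_const
    have h1 := intervalIntegral.norm_integral_le_of_norm_le hu.1
      (f := fun t => toEuclideanLin (B' t) (x t) - toEuclideanLin (B t) (z t) -
        (toEuclideanLin (ω t) (toEuclideanLin (C t) (x t)) +
          toEuclideanLin (W t) (toEuclideanLin (c t) (x t) +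
            toEuclideanLin (C t) (toEuclideanLin (B' t) (x t)))))
      (Eventually.of_forall fun r hr => by
        have hr0 : 0 ≤ r := hs.trans hr.1.le
        have e1 : toEuclideanLin (B' r) (x r) - toEuclideanLin (B r) (z r) -
            (toEuclideanLin (ω r) (toEuclideanLin (C r) (x r)) +
              toEuclideanLin (W r) (toEuclideanLin (c r) (x r) +
                toEuclideanLin (C r) (toEuclideanLin (B' r) (x r)))) =
            toEuclideanLin (B r) (x r - z r) - toEuclideanLin (W r) (toEuclideanLin (c r) (x r) +
                toEuclideanLin (C r) (toEuclideanLin (B' r) (x r))) := by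
          conv_lhs => enter [1, 1]; rw [hBB r hr0]
          rw [map_add, LinearMap.add_apply, toEuclideanLin_mul, map_sub]
          abel
        have hx' := hxm r hr.1.le (hr.2.trans hu.2)
        rw [e1]
        refine (norm_sub_le _ _).trans (add_le_add ?_ ?_)
        · exact (norm_toEuclideanLin_le _ _).trans
            (mul_le_mul_of_nonneg_right (hKb r hr0) (norm_nonneg _))
        · refine (norm_toEuclideanLin_le _ _).trans
            (mul_le_mul (hWε r hr0) ?_ (norm_nonneg _) hε0.le)
          refine (norm_add_le _ _).trans ?_
          rw [add_mul]
          refine add_le_add ((norm_toEuclideanLin_le _ _).trans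
            (mul_le_mul (hkb' r hr0) hx' (norm_nonneg _) hk'.le)) ?_
          rw [mul_assoc]
          refine (norm_toEuclideanLin_le _ _).trans
            (mul_le_mul (hkb r hr0) ?_ (norm_nonneg _) hk.le)
          exact (norm_toEuclideanLin_le _ _).trans
            (mul_le_mul (hB'L r hr0) hx' (norm_nonneg _) hL0)) hi
    rw [← e, intervalIntegral.integral_add
      (((hcont.mono (by
        rw [uIcc_of_le hu.1]; exact Icc_subset_Icc_right hu.2)).intervalIntegrable).const_mul K)
      intervalIntegrable_const, intervalIntegral.integral_const_mul,
      intervalIntegral.integral_const, smul_eq_mul] at h1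
    have h2 : x u - z u = ((x u - z u - toEuclideanLin (W u) (toEuclideanLin (C u) (x u))) -
        (x s - z s - toEuclideanLin (W s) (toEuclideanLin (C s) (x s)))) +
        toEuclideanLin (W u) (toEuclideanLin (C u) (x u)) -
        toEuclideanLin (W s) (toEuclideanLin (C s) (x s)) := by
      rw [hzs]; abel
    have h3 := hWym u hu.1 hu.2
    have h4 := hWym s le_rfl (by linarith)
    have h5 : (u - s) * (ε * ((k' + k * L) * m₀)) ≤ T * (ε * ((k' + k * L) * m₀)) := by
      have : u - s ≤ T := by linarith [hu.2]
      gcongr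
    calc ‖x u - z u‖ ≤ ‖(x u - z u - toEuclideanLin (W u) (toEuclideanLin (C u) (x u))) -
          (x s - z s - toEuclideanLin (W s) (toEuclideanLin (C s) (x s)))‖ +
          ‖toEuclideanLin (W u) (toEuclideanLin (C u) (x u))‖ +
          ‖toEuclideanLin (W s) (toEuclideanLin (C s) (x s))‖ := by
          conv_lhs => rw [h2]
          exact (norm_sub_le _ _).trans (by gcongr; exact norm_add_le _ _)
      _ ≤ (K * (∫ r in s..u, ‖x r - z r‖) + T * (ε * ((k' + k * L) * m₀))) + ε * (k * m₀) +
          ε * (k * m₀) := by linarith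
      _ = _ := by ring
  have hdiff' : ‖x (s + T) - z (s + T)‖ ≤ 1 / 4 * ‖x s‖ := by
    refine hdiff.trans ?_
    rw [add_sub_cancel_left]
    calc _ = ε * Q * ‖x s‖ := by rw [hQ, hm₀]; ring
      _ ≤ _ := by gcongr
  have hz' : ‖z (s + T)‖ ≤ 1 / 4 * ‖x s‖ := by
    have h1 := H z hz s (s + T) hs (by linarith)
    rw [hzs, add_sub_cancel_left] at h1
    exact h1.trans (by gcongr)
  calc ‖x (s + T)‖ = ‖(x (s + T) - z (s + T)) + z (s + T)‖ := by rw [sub_add_cancel]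
    _ ≤ _ := (norm_add_le _ _).trans (by linarith)

end LinearEquation

/-! ### Moving averages of bounded measurable functions. -/

section Smoothing

variable {E : Type*} [NormedAddCommGroup E] [NormedSpace ℝ E]

theorem IsPrimitive.comp_add_right {X f : ℝ → E} (h : IsPrimitive X f) {a : ℝ} (ha : 0 ≤ a) :
    IsPrimitive (fun t => X (t + a)) (fun t => f (t + a)) := fun t ht => by
  have h0 : (0 : ℝ) ≤ t + a := by positivity
  constructor
  · simpa using (h.intervalIntegrable ha h0).comp_add_right a
  · rw [intervalIntegral.integral_comp_add_right, zero_add, ← h.sub_eq ha h0]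
    simp only [zero_add, add_sub_cancel]

theorem IsPrimitive.of_intervalIntegrable {f : ℝ → E}
    (h : ∀ t, 0 ≤ t → IntervalIntegrable f volume 0 t) :
    IsPrimitive (fun t => ∫ s in (0 : ℝ)..t, f s) f := fun t ht => ⟨h t ht, by simp⟩

theorem IsPrimitive.norm_sub_le {X f : ℝ → E} (h : IsPrimitive X f) {K : ℝ}
    (hf : ∀ t, 0 ≤ t → ‖f t‖ ≤ K) {s t : ℝ} (hs : 0 ≤ s) (ht : 0 ≤ t) :
    ‖X s - X t‖ ≤ K * |s - t| := by
  rw [h.sub_eq ht hs]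
  exact intervalIntegral.norm_integral_le_of_norm_le_const fun r hr =>
    hf r ((le_min ht hs).trans hr.1.le)

/-- A bounded measurable function on `J` differs from a bounded Lipschitz one (a moving average)
by the derivative of a uniformly small function. -/
theorem BddMeas.exists_smoothing [CompleteSpace E] {X : ℝ → E} (hX : BddMeas X) {K : ℝ}
    (hK : 0 < K) (hXK : ∀ t, 0 ≤ t → ‖X t‖ ≤ K) {ε : ℝ} (hε : 0 < ε) :
    ∃ Y W : ℝ → E, BddLip Y ∧ (∀ t, 0 ≤ t → ‖Y t‖ ≤ K) ∧ IsPrimitive W (fun t => X t - Y t) ∧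
      ∀ t, 0 ≤ t → ‖W t‖ ≤ ε := by
  set h := ε / K with hh
  have hpos : 0 < h := by positivity
  let U : ℝ → E := fun t => ∫ s in (0 : ℝ)..t, X s
  have hU : IsPrimitive U X :=
    IsPrimitive.of_intervalIntegrable fun t ht => hX.intervalIntegrable le_rfl ht
  let V : ℝ → E := fun t => ∫ s in (0 : ℝ)..t, U s
  have hV : IsPrimitive V U := IsPrimitive.of_intervalIntegrable fun t ht =>
    (hU.continuousOn.mono (by rw [uIcc_of_le ht]; exact Icc_subset_Ici_self)).intervalIntegrable
  have hUL : ∀ {s t : ℝ}, 0 ≤ s → 0 ≤ t → ‖U s - U t‖ ≤ K * |s - t| := fun hs ht =>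
    hU.norm_sub_le hXK hs ht
  have hYK : ∀ t, 0 ≤ t → ‖h⁻¹ • (U (t + h) - U t)‖ ≤ K := by
    intro t ht
    rw [norm_smul, norm_inv, Real.norm_of_nonneg hpos.le, inv_mul_le_iff₀ hpos]
    refine (hUL (by positivity) ht).trans (le_of_eq ?_)
    rw [add_sub_cancel_left, abs_of_pos hpos, mul_comm]
  -- `Y` averages `X` over `[t, t + h]`, and `W` is `U` minus its own average over that interval.
  -- Since `U` is `K`-Lipschitz, `‖W‖ ≤ K h = ε`.
  refine ⟨fun t => h⁻¹ • (U (t + h) - U t), fun t => U t - h⁻¹ • (V (t + h) - V t), ?_, hYK,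
    hU.sub ?_, fun t ht => ?_⟩
  · refine BddLip.of_lipschitzOnWith ⟨K, hYK⟩ ⟨(h⁻¹ * (2 * K)).toNNReal,
      LipschitzOnWith.of_dist_le_mul fun s hs t ht => ?_⟩
    rw [dist_eq_norm, Real.dist_eq, ← smul_sub, norm_smul, norm_inv, Real.norm_of_nonneg hpos.le,
      sub_sub_sub_comm]
    have hs0 : 0 ≤ s := hs
    have ht0 : 0 ≤ t := ht
    have h1 := hUL (s := s + h) (t := t + h) (by positivity) (by positivity)
    rw [add_sub_add_right_eq_sub] at h1
    have h2 := hUL hs0 ht0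
    calc _ ≤ h⁻¹ * (K * |s - t| + K * |s - t|) := by
          gcongr
          exact (_root_.norm_sub_le _ _).trans (add_le_add h1 h2)
      _ = (h⁻¹ * (2 * K)) * |s - t| := by ring
      _ ≤ _ := by gcongr; exact Real.le_coe_toNNReal _
  · exact ((hV.comp_add_right hpos.le).sub hV).clm (h⁻¹ • ContinuousLinearMap.id ℝ E)
  · have ht' : 0 ≤ t + h := by positivity
    have e : U t - h⁻¹ • (V (t + h) - V t) = h⁻¹ • ∫ s in t..(t + h), (U t - U s) := by
      rw [intervalIntegral.integral_sub intervalIntegrable_const (hV.intervalIntegrable ht ht'),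
        ← hV.sub_eq ht ht', intervalIntegral.integral_const, add_sub_cancel_left,
        smul_sub h⁻¹ (h • U t), inv_smul_smul₀ hpos.ne']
    simp only
    rw [e, norm_smul, norm_inv, Real.norm_of_nonneg hpos.le, inv_mul_le_iff₀ hpos]
    have h1 := intervalIntegral.norm_integral_le_of_norm_le_const (a := t) (b := t + h)
      (f := fun s => U t - U s) (C := ε) fun s hs => by
        rw [uIoc_of_le (by linarith)] at hs
        refine (hUL ht (ht.trans hs.1.le)).trans ?_
        have h2 : |t - s| ≤ h := by
          rw [abs_sub_comm, abs_of_nonneg (by linarith [hs.1])]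
          linarith [hs.2]
        calc K * |t - s| ≤ K * h := by gcongr
          _ = ε := by rw [hh]; field_simp
    rw [add_sub_cancel_left, abs_of_pos hpos] at h1
    linarith

end Smoothing

/-! ### The error equation -/

section Algebra

variable {n p q : ℕ} {A N : Matrix (Fin n) (Fin n) ℝ} {D : Matrix (Fin n) (Fin q) ℝ}
  {C C' : Matrix (Fin p) (Fin n) ℝ} {G : Matrix (Fin q) (Fin p) ℝ}
  {L R Y S σ : Matrix (Fin n) (Fin p) ℝ}

theorem output_aux_eq :
    C * (A - D * G * (C * A + C')) + C' = (1 - C * D * G) * (C * A + C') := by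
  rw [Matrix.mul_sub, Matrix.sub_mul, Matrix.one_mul]
  simp only [Matrix.mul_assoc]
  abel

/-- `G` is a left inverse of `C D`, so `D G C D = D` and `1 - C D G` annihilates `C D`. The matrix
`Y` therefore remains free. -/
theorem decoupling (hG : G * (C * D) = 1) :
    (1 - (D * G + Y * (1 - C * D * G)) * C) * D = 0 := by
  have e1 : D * G * C * D = D := by
    rw [Matrix.mul_assoc, Matrix.mul_assoc, hG, Matrix.mul_one]
  have e2 : (1 - C * D * G) * C * D = 0 := by
    rw [Matrix.mul_assoc, Matrix.sub_mul, Matrix.mul_assoc (C * D) G, hG, Matrix.mul_one,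
      Matrix.one_mul, sub_self]
  rw [Matrix.sub_mul, Matrix.one_mul, Matrix.add_mul, Matrix.add_mul, e1, Matrix.mul_assoc Y,
    Matrix.mul_assoc Y, e2, Matrix.mul_zero, add_zero, sub_self]

/-- This `S` gives `S (C A + C') = D G (C A + C') + Y C₂`, hence `N = A - S (C A + C') - L C`. The
terms `N S` and `-σ` in `R` cancel those coming from `N (1 - S C)` and from the derivative of `S`.
-/
theorem error_equation
    (hS : S = D * G + Y * (1 - C * D * G))
    (hN : N = A - D * G * (C * A + C') - L * C - Y * (C * (A - D * G * (C * A + C')) + C'))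
    (hR : R = L + N * S - σ) :
    (0 - (σ * C + S * C')) + (1 - S * C) * A - R * C - N * (1 - S * C) = 0 := by
  have e : S * (C * A + C') =
      D * G * (C * A + C') + Y * (C * (A - D * G * (C * A + C')) + C') := by
    rw [output_aux_eq, hS, Matrix.add_mul (D * G), Matrix.mul_assoc Y]
  have hN' : N = A - S * (C * A + C') - L * C := by
    rw [hN, e]; abel
  have h1 : (0 - (σ * C + S * C')) + (1 - S * C) * A - R * C - N * (1 - S * C) =
      (A - S * (C * A + C') - L * C) - N := by
    rw [hR]
    simp only [Matrix.sub_mul, Matrix.add_mul, Matrix.mul_sub, Matrix.mul_add, Matrix.mul_one,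
      Matrix.one_mul, Matrix.mul_assoc]
    abel
  rw [h1, ← hN', sub_self]

/-- Decoupling reads `D = S C D`, so for any `G` the product `S (C A + C')` splits into `D G (C A +
C')` and `S C₂`. This exhibits `N` as an output injection for the pair `(Ã, C̃)`. -/
theorem observer_matrix_eq (hT : (1 - S * C) * D = 0)
    (h : (0 - (σ * C + S * C')) + (1 - S * C) * A - R * C - N * (1 - S * C) = 0) :
    N = A - D * G * (C * A + C') -
      ((R + σ - N * S) * C + S * (C * (A - D * G * (C * A + C')) + C')) := by
  have hD : D = S * C * D := by
    rwa [Matrix.sub_mul, Matrix.one_mul, sub_eq_zero] at hT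
  have hDG : D * G * (C * A + C') = S * (C * D * G * (C * A + C')) := by
    conv_lhs => rw [hD]
    simp only [Matrix.mul_assoc]
  rw [output_aux_eq, Matrix.sub_mul 1, Matrix.one_mul, Matrix.mul_sub S, ← hDG]
  rw [← sub_eq_zero, ← neg_eq_zero, ← h]
  simp only [Matrix.sub_mul, Matrix.add_mul, Matrix.mul_sub, Matrix.mul_add, Matrix.mul_one,
    Matrix.one_mul, Matrix.mul_assoc]
  abel

end Algebra

section ErrorEquation

variable {n p q : ℕ} {A N : ℝ → Matrix (Fin n) (Fin n) ℝ} {D : ℝ → Matrix (Fin n) (Fin q) ℝ}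
  {C C' : ℝ → Matrix (Fin p) (Fin n) ℝ} {R S σ : ℝ → Matrix (Fin n) (Fin p) ℝ}

theorem isPrimitive_one_sub_mul (hS : IsPrimitive S σ) (hC : IsPrimitive C C') :
    IsPrimitive (fun t => 1 - S t * C t) (fun t => 0 - (σ t * C t + S t * C' t)) :=
  (IsPrimitive.const 1).sub (hS.matrix_mul hC)

/-- The estimation error of an observer, for an arbitrary input. -/
theorem isPrimitive_error (hS : IsPrimitive S σ) (hC : IsPrimitive C C')
    {w : ℝ → EuclideanSpace ℝ (Fin q)} {x z : ℝ → EuclideanSpace ℝ (Fin n)}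
    {y : ℝ → EuclideanSpace ℝ (Fin p)}
    (hx : IsSolution (fun t v => toEuclideanLin (A t) v + toEuclideanLin (D t) (w t)) x)
    (hy : ∀ t, 0 ≤ t → y t = toEuclideanLin (C t) (x t))
    (hz : IsSolution (fun t v => toEuclideanLin (N t) v + toEuclideanLin (R t) (y t)) z) :
    IsPrimitive (fun t => x t - (z t + toEuclideanLin (S t) (y t))) (fun t =>
      toEuclideanLin ((0 - (σ t * C t + S t * C' t)) + (1 - S t * C t) * A t - R t * C t -
        N t * (1 - S t * C t)) (x t) + toEuclideanLin ((1 - S t * C t) * D t) (w t) +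
      toEuclideanLin (N t) (x t - (z t + toEuclideanLin (S t) (y t)))) := by
  have hxp : IsPrimitive x (fun t => toEuclideanLin (A t) (x t) + toEuclideanLin (D t) (w t)) := hx
  have hzp : IsPrimitive z (fun t => toEuclideanLin (N t) (z t) + toEuclideanLin (R t) (y t)) := hz
  refine (((isPrimitive_one_sub_mul hS hC).toEuclideanLin hxp).sub hzp).congr (fun t ht => ?_)
    (Eventually.of_forall fun t ht => ?_)
  · simp only [hy t ht, map_sub, LinearMap.sub_apply, toEuclideanLin_one_apply, toEuclideanLin_mul]
    abel
  · simp only [hy t ht, map_sub, map_add, LinearMap.sub_apply, LinearMap.add_apply,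
      toEuclideanLin_one_apply, toEuclideanLin_mul]
    abel

end ErrorEquation

/-! ### Necessity: what a strong observer must satisfy. -/

section Necessity

variable {n p q : ℕ} {A N : ℝ → Matrix (Fin n) (Fin n) ℝ} {D : ℝ → Matrix (Fin n) (Fin q) ℝ}
  {C C' : ℝ → Matrix (Fin p) (Fin n) ℝ} {R S σ : ℝ → Matrix (Fin n) (Fin p) ℝ}

/-- Plant and observer, driven by a constant input, can be started anywhere at any time. -/
theorem exists_joint_solution (hA : BddMeas A) (hD : BddMeas D) (hC : BddMeas C) (hN : BddMeas N)
    (hR : BddMeas R) (w : EuclideanSpace ℝ (Fin q)) (s : ℝ) (v₁ v₂ : EuclideanSpace ℝ (Fin n)) :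
    ∃ x z, x s = v₁ ∧ z s = v₂ ∧
      IsSolution (fun t v => toEuclideanLin (A t) v + toEuclideanLin (D t) w) x ∧
      IsSolution (fun t v => toEuclideanLin (N t) v +
        toEuclideanLin (R t) (toEuclideanLin (C t) (x t))) z := by
  let f : ℝ → EuclideanSpace ℝ (Fin n) × EuclideanSpace ℝ (Fin n) →
      EuclideanSpace ℝ (Fin n) × EuclideanSpace ℝ (Fin n) := fun t u =>
    (toEuclideanLin (A t) u.1 + toEuclideanLin (D t) w,
      toEuclideanLin (N t) u.2 + toEuclideanLin (R t) (toEuclideanLin (C t) u.1))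
  obtain ⟨a, ha, hAb⟩ := hA.exists_bound
  obtain ⟨d, hd, hDb⟩ := hD.exists_bound
  obtain ⟨c, hc, hCb⟩ := hC.exists_bound
  obtain ⟨b, hb, hNb⟩ := hN.exists_bound
  obtain ⟨r, hr, hRb⟩ := hR.exists_bound
  obtain ⟨u, hu, hsol⟩ := exists_isSolution f (K := a + b + r * c + d * ‖w‖)
    (fun u hu => by
      have h1 : ContinuousOn (fun t => (u t).1) (Ici 0) := continuous_fst.comp_continuousOn hu
      have h2 : ContinuousOn (fun t => (u t).2) (Ici 0) := continuous_snd.comp_continuousOn hu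
      exact ((hA.aestronglyMeasurable_mulVec h1).add
        (hD.aestronglyMeasurable_mulVec continuousOn_const)).prodMk
        ((hN.aestronglyMeasurable_mulVec h2).add
          (aestronglyMeasurable_toEuclideanLin hR.2 (hC.aestronglyMeasurable_mulVec h1))))
    (fun t ht u v => by
      have e : f t u - f t v = (toEuclideanLin (A t) (u - v).1, toEuclideanLin (N t) (u - v).2 +
          toEuclideanLin (R t) (toEuclideanLin (C t) (u - v).1)) := by
        simp only [f, Prod.mk_sub_mk, Prod.fst_sub, Prod.snd_sub, map_sub, Prod.mk.injEq]
        constructor <;> abel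
      rw [e]
      have h1 : ‖(u - v).1‖ ≤ ‖u - v‖ := norm_fst_le _
      have h2 : ‖(u - v).2‖ ≤ ‖u - v‖ := norm_snd_le _
      have e1 : ‖toEuclideanLin (A t) (u - v).1‖ ≤ a * ‖u - v‖ :=
        (norm_toEuclideanLin_le _ _).trans (mul_le_mul (hAb t ht) h1 (norm_nonneg _) ha.le)
      have e2 : ‖toEuclideanLin (N t) (u - v).2‖ ≤ b * ‖u - v‖ :=
        (norm_toEuclideanLin_le _ _).trans (mul_le_mul (hNb t ht) h2 (norm_nonneg _) hb.le)
      have e3 : ‖toEuclideanLin (R t) (toEuclideanLin (C t) (u - v).1)‖ ≤ r * (c * ‖u - v‖) :=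
        (norm_toEuclideanLin_le _ _).trans (mul_le_mul (hRb t ht)
          ((norm_toEuclideanLin_le _ _).trans (mul_le_mul (hCb t ht) h1 (norm_nonneg _) hc.le))
          (norm_nonneg _) hr.le)
      have e4 : 0 ≤ d * ‖w‖ * ‖u - v‖ := by positivity
      have e5 : 0 ≤ r * (c * ‖u - v‖) := by positivity
      have e6 : 0 ≤ a * ‖u - v‖ := by positivity
      have e7 : 0 ≤ b * ‖u - v‖ := by positivity
      refine norm_prod_le_iff.2 ⟨by simp only; nlinarith, ?_⟩
      refine (norm_add_le _ _).trans ?_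
      nlinarith)
    (fun t ht => by
      have e1 : ‖toEuclideanLin (D t) w‖ ≤ d * ‖w‖ :=
        (norm_toEuclideanLin_le _ _).trans (mul_le_mul_of_nonneg_right (hDb t ht) (norm_nonneg _))
      have e2 : 0 ≤ d * ‖w‖ := by positivity
      have e3 : 0 ≤ r * c := by positivity
      refine norm_prod_le_iff.2 ⟨?_, ?_⟩
      · simp only [f, Prod.fst_zero, map_zero, zero_add]
        linarith
      · simp only [f, Prod.fst_zero, Prod.snd_zero, map_zero, zero_add, norm_zero]
        linarith) s (v₁, v₂)
  have hp : IsPrimitive u (fun t => f t (u t)) := hsol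
  have h1 : IsPrimitive (fun t => (u t).1) (fun t => (f t (u t)).1) :=
    hp.clm (ContinuousLinearMap.fst ℝ _ _)
  have h2 : IsPrimitive (fun t => (u t).2) (fun t => (f t (u t)).2) :=
    hp.clm (ContinuousLinearMap.snd ℝ _ _)
  exact ⟨fun t => (u t).1, fun t => (u t).2, congrArg Prod.fst hu, congrArg Prod.snd hu, h1, h2⟩

/-- If through every point there passes a curve along which `P(t) x(t) + b(t)` integrates to zero,
then `P(t) v + b(t)` vanishes almost everywhere, for every fixed `v`. -/
theorem ae_eq_zero_of_curves {P : ℝ → Matrix (Fin n) (Fin n) ℝ} (hP : BddMeas P)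
    {b : ℝ → EuclideanSpace ℝ (Fin n)} (hb : BddMeas b) (v : EuclideanSpace ℝ (Fin n))
    (h : ∀ s, 0 ≤ s → ∃ x : ℝ → EuclideanSpace ℝ (Fin n), x s = v ∧ ContinuousOn x (Ici 0) ∧
      ∀ t, s ≤ t → ∫ r in s..t, (toEuclideanLin (P r) (x r) + b r) = 0) :
    ∀ᵐ t, 0 ≤ t → toEuclideanLin (P t) v + b t = 0 := by
  have hg : BddMeas fun t => toEuclideanLin (P t) v + b t := (hP.mulVec_const v).add hb
  have hΨ : IsPrimitive (fun t => ∫ r in (0 : ℝ)..t, (toEuclideanLin (P r) v + b r))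
      (fun t => toEuclideanLin (P t) v + b t) :=
    IsPrimitive.of_intervalIntegrable fun t ht => hg.intervalIntegrable le_rfl ht
  refine hΨ.ae_eq_zero fun t ht => ?_
  -- The right derivative of `∫ (P v + b)` vanishes at every `s`: subtracting the zero integral
  -- along the curve through `v` leaves `∫ P (v - x)`, and `v - x` is small near `s`. Hence the
  -- primitive is constant.
  refine constant_of_has_deriv_right_zero (hΨ.continuousOn.mono Icc_subset_Ici_self)
    (fun s hs => ?_) t (right_mem_Icc.2 ht)
  have hs0 : 0 ≤ s := hs.1
  obtain ⟨x, hxs, hxc, hx⟩ := h s hs0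
  obtain ⟨K, hK, hPK⟩ := hP.exists_bound
  rw [hasDerivWithinAt_iff_isLittleO, Asymptotics.isLittleO_iff]
  intro c hc
  have hnear : ∀ᶠ r in 𝓝[Ici s] s, ‖v - x r‖ < c / K := by
    have h1 : ContinuousWithinAt (fun r => ‖v - x r‖) (Ici s) s :=
      ((continuousWithinAt_const.sub (hxc s hs0)).norm).mono (Ici_subset_Ici.2 hs0)
    refine h1.eventually_lt continuousWithinAt_const ?_
    simp only [hxs, sub_self, norm_zero]
    positivity
  rw [eventually_nhdsWithin_iff, Metric.eventually_nhds_iff] at hnear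
  obtain ⟨δ, hδ, hnear⟩ := hnear
  rw [eventually_nhdsWithin_iff, Metric.eventually_nhds_iff]
  refine ⟨δ, hδ, fun u hu hus => ?_⟩
  have hus' : s ≤ u := hus
  have hu0 : 0 ≤ u := hs0.trans hus'
  have hsub : uIcc s u ⊆ Ici 0 := by
    rw [uIcc_of_le hus']; exact fun r hr => hs0.trans hr.1
  have hPx : IntervalIntegrable (fun r => toEuclideanLin (P r) (x r) + b r) volume s u := by
    obtain ⟨k, hk⟩ := isCompact_uIcc.exists_bound_of_continuousOn (hxc.mono hsub)
    refine IntervalIntegrable.add ?_ (hb.intervalIntegrable hs0 hu0)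
    refine (intervalIntegrable_const (c := K * k)).mono_fun
      ((hP.aestronglyMeasurable_mulVec hxc).mono_set (uIoc_subset_uIcc.trans hsub)) ?_
    filter_upwards [ae_restrict_mem measurableSet_uIoc] with r hr
    have hr' := uIoc_subset_uIcc hr
    refine ((norm_toEuclideanLin_le _ _).trans ?_).trans (le_abs_self _)
    exact mul_le_mul (hPK r (hsub hr')) (hk r hr') (norm_nonneg _) hK.le
  rw [smul_zero, sub_zero, hΨ.sub_eq hs0 hu0,
    ← sub_zero (∫ r in s..u, (toEuclideanLin (P r) v + b r)), ← hx u hus',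
    ← intervalIntegral.integral_sub (hg.intervalIntegrable hs0 hu0) hPx]
  refine intervalIntegral.norm_integral_le_of_norm_le_const fun r hr => ?_
  rw [uIoc_of_le hus'] at hr
  have hr1 : ‖v - x r‖ < c / K := by
    refine hnear ?_ hr.1.le
    rw [Real.dist_eq, abs_of_nonneg (by linarith)] at hu
    rw [Real.dist_eq, abs_of_nonneg (by linarith [hr.1])]
    linarith [hr.2]
  rw [add_sub_add_right_eq_sub, ← map_sub]
  refine (norm_toEuclideanLin_le _ _).trans ?_
  calc ‖P r‖ * ‖v - x r‖ ≤ K * (c / K) := by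
        gcongr
        exact hPK r (hs0.trans hr.1.le)
    _ = c := by field_simp

/-- The exceptional null set may depend on `v`; finitely many basis vectors give a common one. -/
theorem ae_matrix_eq_zero {m k : ℕ} {P : ℝ → Matrix (Fin m) (Fin k) ℝ}
    (h : ∀ v, ∀ᵐ t, 0 ≤ t → toEuclideanLin (P t) v = 0) : ∀ᵐ t : ℝ, 0 ≤ t → P t = 0 := by
  filter_upwards [ae_all_iff.2 fun j => h (EuclideanSpace.single j 1)] with t ht h0
  ext i j
  have := congrFun (congrArg WithLp.ofLp (ht j h0)) i
  simpa [toLpLin_apply] using this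

/-- An observer which works for all inputs is decoupled from the input, and its error obeys the
homogeneous observer equation. -/
theorem IsStrongObserver.ae_decoupled (hA : BddMeas A) (hD : BddMeas D) (hC : BddLip C)
    (hC' : BddMeas C') (hCC' : IsPrimitive C C') (hN : BddMeas N) (hR : BddMeas R) (hS : BddLip S)
    (hσ : BddMeas σ) (hSσ : IsPrimitive S σ) (hO : IsStrongObserver A D C N R S) :
    (∀ᵐ t, 0 ≤ t → (1 - S t * C t) * D t = 0) ∧
    ∀ᵐ t, 0 ≤ t → (0 - (σ t * C t + S t * C' t)) + (1 - S t * C t) * A t - R t * C t -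
      N t * (1 - S t * C t) = 0 := by
  obtain ⟨M, μ, hM, hμ, H⟩ := hO
  set P : ℝ → Matrix (Fin n) (Fin n) ℝ := fun t => (0 - (σ t * C t + S t * C' t)) +
    (1 - S t * C t) * A t - R t * C t - N t * (1 - S t * C t) with hPdef
  have hCm := hC.bddMeas
  have hSm := hS.bddMeas
  have hTm : BddMeas fun t => 1 - S t * C t := (BddLip.const 1).bddMeas.sub (hSm.matrix_mul hCm)
  have hP : BddMeas P :=
    (((((BddLip.const 0).bddMeas.sub ((hσ.matrix_mul hCm).add (hSm.matrix_mul hC'))).add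
      (hTm.matrix_mul hA)).sub (hR.matrix_mul hCm)).sub (hN.matrix_mul hTm))
  have hTD : BddMeas fun t => (1 - S t * C t) * D t := hTm.matrix_mul hD
  have key : ∀ v w, ∀ᵐ t, 0 ≤ t → toEuclideanLin (P t) v +
      toEuclideanLin ((1 - S t * C t) * D t) w = 0 := by
    intro v w
    refine ae_eq_zero_of_curves hP (hTD.mulVec_const w) v fun s hs => ?_
    -- The observer starts at `v - S(s) C(s) v`, so that the error vanishes at time `s` and
    -- therefore ever after.
    obtain ⟨x, z, hxs, hzs, hx, hz⟩ := exists_joint_solution hA hD hCm hN hR w s v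
      (v - toEuclideanLin (S s) (toEuclideanLin (C s) v))
    have hxp : IsPrimitive x (fun t => toEuclideanLin (A t) (x t) + toEuclideanLin (D t) w) := hx
    refine ⟨x, hxs, hxp.continuousOn, fun t hst => ?_⟩
    have hB := H (fun _ => w) x z (fun t => toEuclideanLin (C t) (x t))
      (fun t => z t + toEuclideanLin (S t) (toEuclideanLin (C t) (x t)))
      (continuous_const.continuousOn.locallyIntegrableOn measurableSet_Ici) hx (fun _ _ => rfl) hz
      (fun _ _ => rfl)
    have hs' : x s - (z s + toEuclideanLin (S s) (toEuclideanLin (C s) (x s))) = 0 := by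
      rw [hxs, hzs]; abel
    have hzero : ∀ r, s ≤ r →
        x r - (z r + toEuclideanLin (S r) (toEuclideanLin (C r) (x r))) = 0 := by
      intro r hr
      have := hB s r hs hr
      simp only [hs', norm_zero, mul_zero] at this
      exact norm_le_zero_iff.1 this
    have hE := (isPrimitive_error hSσ hCC' hx (fun _ _ => rfl) hz).sub_eq hs (hs.trans hst)
    simp only [hzero t hst, hs', sub_zero] at hE
    rw [hE]
    refine intervalIntegral.integral_congr fun r hr => ?_
    rw [uIcc_of_le hst] at hr
    simp only [hzero r hr.1, map_zero, add_zero, hPdef]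
  refine ⟨ae_matrix_eq_zero fun w => ?_, ae_matrix_eq_zero fun v => ?_⟩
  · filter_upwards [key 0 w] with t ht h0
    simpa using ht h0
  · filter_upwards [key v 0] with t ht h0
    have h1 := ht h0
    rwa [map_zero, add_zero] at h1

/-- The homogeneous observer equation of a strong observer is exponentially stable. -/
theorem IsStrongObserver.ues (hO : IsStrongObserver A D C N R S) : UES N := by
  obtain ⟨M, μ, hM, hμ, H⟩ := hO
  refine ⟨M, μ, hM, hμ, fun e he => ?_⟩
  -- With `w = 0` and `x = 0`, the observer state `-e` is admissible and its estimation error is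
  -- `e`.
  have hz : IsPrimitive (fun t => -e t) (fun t => -toEuclideanLin (N t) (e t)) := by
    simpa only [zero_sub, sub_zero] using (IsPrimitive.const (0 : EuclideanSpace ℝ (Fin n))).sub he
  have h1 := H (fun _ => 0) (fun _ => 0) (fun t => -e t) (fun _ => 0) (fun t => -e t)
    (continuous_const.continuousOn.locallyIntegrableOn measurableSet_Ici)
    (by
      change IsPrimitive _ _
      simpa using IsPrimitive.const (0 : EuclideanSpace ℝ (Fin n))) (by simp)
    (by
      change IsPrimitive _ _
      simpa using hz) (by simp)
  simpa using h1

end Necessity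

/-! ### The two implications. -/

section Equivalence

variable {n p q : ℕ} {A : ℝ → Matrix (Fin n) (Fin n) ℝ} {D : ℝ → Matrix (Fin n) (Fin q) ℝ}
  {C : ℝ → Matrix (Fin p) (Fin n) ℝ}

theorem bddLip_auxA (hA : BddLip A) (hD : BddLip D) (hC : BddLip C) (hC' : BddLip (dot C))
    (hG : BddLip fun t => pinv (C t * D t)) : BddLip (auxA A D C) :=
  hA.sub ((hD.matrix_mul hG).matrix_mul ((hC.matrix_mul hA).add hC'))

theorem detectable_of_strongStarDetectable (hA : BddLip A) (hD : BddLip D) (hC : BddLip C)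
    (hC' : BddLip (dot C)) (hCC' : IsPrimitive C (dot C))
    (h : UniformlyStrongStarDetectable A D C) :
    UniformlyExponentiallyDetectable (auxA A D C) (auxC A D C) := by
  obtain ⟨N, R, S, hNm, hNb, hRm, hRb, hSb, hSL, hO⟩ := h
  have hN := BddMeas.of_measurableMatrix hNm hNb
  have hR := BddMeas.of_measurableMatrix hRm hRb
  have hS := BddLip.of_lipschitzOnWith hSb hSL
  obtain ⟨σ, hσ, hSσ⟩ := hS.exists_isPrimitive
  obtain ⟨h1, h2⟩ := hO.ae_decoupled hA.bddMeas hD.bddMeas hC hC'.bddMeas hCC' hN hR hS hσ hSσ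
  have hL₁ : BddMeas fun t => R t + σ t - N t * S t :=
    (hR.add hσ).sub (hN.matrix_mul hS.bddMeas)
  -- The detector gain is the block row `[R + σ - N S, S]` supplied by `observer_matrix_eq`.
  have hL : BddMeas fun t => (R t + σ t - N t * S t) *
      fromCols (1 : Matrix (Fin p) (Fin p) ℝ) (0 : Matrix (Fin p) (Fin p) ℝ) +
      S t * fromCols (0 : Matrix (Fin p) (Fin p) ℝ) (1 : Matrix (Fin p) (Fin p) ℝ) :=
    (hL₁.matrix_mul (BddLip.const _).bddMeas).add
      (hS.bddMeas.matrix_mul (BddLip.const _).bddMeas)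
  obtain ⟨L, hLm, hLb, hLeq⟩ := hL.exists_measurableMatrix
  refine ⟨L, hLm, hLb, hO.ues.congr_ae ?_⟩
  filter_upwards [h1, h2, hLeq] with t ht1 ht2 ht3 ht
  rw [← ht3 ht]
  refine (observer_matrix_eq (G := pinv (C t * D t)) (ht1 ht) (ht2 ht)).trans ?_
  simp only [auxC, auxA, Matrix.add_mul, Matrix.mul_assoc, fromCols_mul_fromRows, Matrix.one_mul,
    Matrix.zero_mul, add_zero, zero_add]

theorem strongStarDetectable_of_detectable (hA : BddLip A) (hD : BddLip D) (hC : BddLip C)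
    (hC' : BddLip (dot C)) (hCC' : IsPrimitive C (dot C))
    (hG : BddLip fun t => pinv (C t * D t))
    (hinv : ∀ t, 0 ≤ t → pinv (C t * D t) * (C t * D t) = 1)
    (h : UniformlyExponentiallyDetectable (auxA A D C) (auxC A D C)) :
    UniformlyStrongStarDetectable A D C := by
  obtain ⟨L, hLm, hLb, hU⟩ := h
  have hL := BddMeas.of_measurableMatrix hLm hLb
  set L₁ : ℝ → Matrix (Fin n) (Fin p) ℝ := fun t => L t *
    fromRows (1 : Matrix (Fin p) (Fin p) ℝ) (0 : Matrix (Fin p) (Fin p) ℝ) with hL₁def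
  set L₂ : ℝ → Matrix (Fin n) (Fin p) ℝ := fun t => L t *
    fromRows (0 : Matrix (Fin p) (Fin p) ℝ) (1 : Matrix (Fin p) (Fin p) ℝ) with hL₂def
  have hL₁ : BddMeas L₁ := hL.matrix_mul (BddLip.const _).bddMeas
  have hL₂ : BddMeas L₂ := hL.matrix_mul (BddLip.const _).bddMeas
  set C₂ : ℝ → Matrix (Fin p) (Fin n) ℝ := fun t => C t * auxA A D C t + dot C t with hC₂def
  have hAux := bddLip_auxA hA hD hC hC' hG
  have hC₂ : BddLip C₂ := (hC.matrix_mul hAux).add hC'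
  have hBeq : ∀ t, auxA A D C t - L t * auxC A D C t =
      auxA A D C t - L₁ t * C t - L₂ t * C₂ t := by
    intro t
    have e : L t * auxC A D C t = L₁ t * C t + L₂ t * C₂ t := by
      simp only [hL₁def, hL₂def, Matrix.mul_assoc, ← Matrix.mul_add, fromRows_mul, Matrix.one_mul,
        Matrix.zero_mul]
      congr 1
      ext i j
      cases i <;> simp [auxC, hC₂def]
    rw [e]; abel
  have hB₀ : BddMeas fun t => auxA A D C t - L₁ t * C t :=
    hAux.bddMeas.sub (hL₁.matrix_mul hC.bddMeas)
  have hB : BddMeas fun t => auxA A D C t - L₁ t * C t - L₂ t * C₂ t :=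
    hB₀.sub (hL₂.matrix_mul hC₂.bddMeas)
  have hUB : UES fun t => auxA A D C t - L₁ t * C t - L₂ t * C₂ t := by
    simpa only [hBeq] using hU
  obtain ⟨a, ha, hab⟩ := hB₀.exists_bound
  obtain ⟨k, hk, hkb⟩ := hL₂.exists_bound
  obtain ⟨c, hc, hcb⟩ := hC₂.bddMeas.exists_bound
  -- The bound `a + k c` for the averaged matrix is available before `ε` is chosen, because
  -- averaging does not increase the bound `k` of `L₂`.
  obtain ⟨ε, hε, H⟩ := hUB.exists_averaging hB hC₂ (a + k * c)
  obtain ⟨Y, W, hY, hYb, hW, hWb⟩ := hL₂.exists_smoothing hk hkb hε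
  set N₀ : ℝ → Matrix (Fin n) (Fin n) ℝ := fun t =>
    auxA A D C t - L₁ t * C t - Y t * C₂ t with hN₀def
  have hN₀U : UES N₀ := by
    refine H N₀ W _ (fun t ht => ?_) hW hWb fun t _ => ?_
    · refine (norm_sub_le _ _).trans (add_le_add (hab t ht) ?_)
      exact (l2_opNorm_mul _ _).trans
        (mul_le_mul (hYb t ht) (hcb t ht) (norm_nonneg _) hk.le)
    · simp only [hN₀def, Matrix.sub_mul]; abel
  have hN₀ : BddMeas N₀ := hB₀.sub (hY.bddMeas.matrix_mul hC₂.bddMeas)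
  set S : ℝ → Matrix (Fin n) (Fin p) ℝ := fun t =>
    D t * pinv (C t * D t) + Y t * (1 - C t * D t * pinv (C t * D t)) with hSdef
  have hS : BddLip S := (hD.matrix_mul hG).add
    (hY.matrix_mul ((BddLip.const 1).sub ((hC.matrix_mul hD).matrix_mul hG)))
  obtain ⟨σ, hσ, hSσ⟩ := hS.exists_isPrimitive
  have hR₀ : BddMeas fun t => L₁ t + N₀ t * S t - σ t :=
    (hL₁.add (hN₀.matrix_mul hS.bddMeas)).sub hσ
  -- Changing `N₀` and the gain on null sets affects neither stability nor the error equation, both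
  -- of which involve them only almost everywhere.
  obtain ⟨N, hNm, hNb, hNeq⟩ := hN₀.exists_measurableMatrix
  obtain ⟨R, hRm, hRb, hReq⟩ := hR₀.exists_measurableMatrix
  refine ⟨N, R, S, hNm, hNb, hRm, hRb, hS.uniformlyBounded, hS.lipschitzOnWith, ?_⟩
  obtain ⟨M, μ, hM, hμ, HN⟩ := hN₀U.congr_ae hNeq
  refine ⟨M, μ, hM, hμ, fun w x z y xhat _ hx hy hz hxhat => HN _ ?_⟩
  refine (isPrimitive_error hSσ hCC' hx hy hz).congr (fun t ht => by rw [hxhat t ht]) ?_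
  filter_upwards [hNeq, hReq] with t htN htR ht
  rw [decoupling (hinv t ht), error_equation (L := L₁ t) (Y := Y t) rfl
    (by rw [← htN ht]; simp only [hN₀def, hC₂def, auxA]) (by rw [← htR ht, ← htN ht]),
    hxhat t ht]
  simp

end Equivalence

end StrongDetect

theorem mainTheorem1 {n p q : ℕ}
    (A : ℝ → Matrix (Fin n) (Fin n) ℝ) (D : ℝ → Matrix (Fin n) (Fin q) ℝ)
    (C : ℝ → Matrix (Fin p) (Fin n) ℝ)
    (hA : StrongDetect.UniformlyBounded A) (hA_diff : DifferentiableOn ℝ A (Set.Ici 0))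
    (hA_dot : StrongDetect.UniformlyBounded (StrongDetect.dot A))
    (hD : StrongDetect.UniformlyBounded D) (hD_diff : DifferentiableOn ℝ D (Set.Ici 0))
    (hD_dot : StrongDetect.UniformlyBounded (StrongDetect.dot D))
    (hC : StrongDetect.UniformlyBounded C) (hC_diff : DifferentiableOn ℝ C (Set.Ici 0))
    (hC_dot : StrongDetect.UniformlyBounded (StrongDetect.dot C))
    (hC_diff2 : DifferentiableOn ℝ (StrongDetect.dot C) (Set.Ici 0))
    (hC_dot2 : StrongDetect.UniformlyBounded (StrongDetect.dot (StrongDetect.dot C)))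
    (hΓ : ∃ γ : ℝ, 0 < γ ∧ ∀ t : ℝ, 0 ≤ t →
      ((C t * D t).transpose * (C t * D t) -
        γ • (1 : Matrix (Fin q) (Fin q) ℝ)).PosSemidef) :
    StrongDetect.UniformlyStrongStarDetectable A D C ↔
      StrongDetect.UniformlyExponentiallyDetectable
        (StrongDetect.auxA A D C) (StrongDetect.auxC A D C) := by
  obtain ⟨γ, hγ, hpos⟩ := hΓ
  have hAL := StrongDetect.BddLip.of_derivWithin hA hA_diff hA_dot
  have hDL := StrongDetect.BddLip.of_derivWithin hD hD_diff hD_dot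
  have hCL := StrongDetect.BddLip.of_derivWithin hC hC_diff hC_dot
  have hCL' := StrongDetect.BddLip.of_derivWithin hC_dot hC_diff2 hC_dot2
  -- Twice differentiability makes `Ċ` continuous, so `C` is the integral of its pointwise
  -- derivative.
  have hCC' : StrongDetect.IsPrimitive C (StrongDetect.dot C) :=
    StrongDetect.IsPrimitive.of_derivWithin hC_diff hC_diff2.continuousOn
  exact ⟨StrongDetect.detectable_of_strongStarDetectable hAL hDL hCL hCL' hCC',
    StrongDetect.strongStarDetectable_of_detectable hAL hDL hCL hCL' hCC'
      ((hCL.matrix_mul hDL).pinv hγ hpos) fun t ht => StrongDetect.pinv_mul_self_of_isUnit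
        (StrongDetect.isUnit_det_of_posSemidef_sub hγ (hpos t ht))⟩
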